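/- Let $\mathcal H$ be a complex Hilbert space and let $\mathcal M$ be a variational manifold: a finite-dimensional smooth real (Hausdorff) manifold with a smooth immersion $x\mapsto\psi(x)$ into the projective Hilbert space $\mathcal P(\mathcal H)$ (for instance a submanifold). For a local smooth choice of representatives $|\psi(x)\rangle\in\mathcal H\setminus\{0\}$ put $$\mathbb Q_\psi|\phi\rangle=|\phi\rangle-\frac{\langle\psi|\phi\rangle}{\langle\psi|\psi\rangle}|\psi\rangle,\qquad |V_\mu\rangle=\mathbb Q_{\psi}\,\partial_\mu|\psi(x)\rangle,\qquad \bm g_{\mu\nu}=\frac{2\,\mathrm{Re}\langle V_\mu|V_\nu\rangle}{\langle\psi|\psi\rangle},\qquad \bm\omega_{\mu\nu}=\frac{2\,\mathrm{Im}\langle V_\mu|V_\nu\rangle}{\langle\psi|\psi\rangle}.$$ Let $\bm\Omega^{\mu\nu}$ be the inverse of $\bm\omega_{\mu\nu}$ or, if $\bm\omega$ is degenerate, its pseudo-inverse with respect to $\bm g$ (the inverse of $\bm\omega$ on the $\bm g$-orthogonal complement of $\ker\bm\omega$, extended by zero). For a Hermitian, possibly unbounded, operator $\hat A$ whose domain contains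 the states of $\mathcal M$ put $A(x)=\langle\psi(x)|\hat A|\psi(x)\rangle/\langle\psi(x)|\psi(x)\rangle$. The projected real time evolution (Lagrangian action principle) with a possibly time-dependent Hamiltonian $\hat H(t)$ is $$\frac{dx^\mu}{dt}=-\bm\Omega^{\mu\nu}\,\partial_\nu E(t)\big|_{x(t)},\qquad E(t)(x)=\frac{\langle\psi(x)|\hat H(t)|\psi(x)\rangle}{\langle\psi(x)|\psi(x)\rangle}.$$ Let $\hat H_0$ and $\hat A(s)$, $s\in\mathbb R$, be Hermitian operators and let $t_0\le t$. Assume that the domains of $\hat H_0$ and of $\hat A(s)$, $s\in[t_0,t]$, contain the states of $\mathcal M$, that the energy function of $\hat H_0$ is $C^2$ on $\mathcal M$, that $A(s)$ is $C^1$ on $\mathcal M$ for $s\in[t_0,t]$, and that its differential $\partial_\rho A(s)|_x$ is jointly continuous in $(s,x)$ for $s\in[t_0,t]$. Let $\psi(s)=\psi(x(s))$, $s\in[t_0,t]$, be a free projected evolution with Hamiltonian $\hat H_0$, and for all small $\epsilon\neq0$ let $\psi_\epsilon(s)=\psi(x_\epsilon(s))$, $s\in[t_0,t]$, be a perturbed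 projected evolution with Hamiltonian $\hat H_0+\epsilon\hat A(s)$, all with the same initial state at time $t_0$. Assume that the rank of $\bm\omega$ is constant in a neighbourhood of each point of the free trajectory. Let $\Phi_s$ be the (in general only locally defined) flow of the free projected evolution. Then, for all $s\in[t_0,t]$, $\Phi_{t-s}$ is differentiable at $\psi(s)$ and maps it to $\psi(t)$; let $d\Phi_{t-s}:\mathcal T_{\psi(s)}\mathcal M\to\mathcal T_{\psi(t)}\mathcal M$ be its differential there (the linearized free flow). The map $\epsilon\mapsto x_\epsilon(t)$, with $x_0:=x$, is differentiable at $\epsilon=0$, and so is $\epsilon\mapsto|\psi_\epsilon(t)\rangle$ for every smooth choice of representatives near $\psi(t)$. The first-order deviation $\delta x^\mu(t)=\frac{d}{d\epsilon}x^\mu_\epsilon(t)\big|_{\epsilon=0}$ satisfies $$\delta x^\mu(t)\,|V_\mu\rangle=\mathbb Q_{\psi(t)}\,\frac{d}{d\epsilon}|\psi_\epsilon(t)\rangle\Big|_{\epsilon=0}$$ and is given by $$\delta x^\mu(t)=-\int_{t_0}^{t}ds\,(d\Phi_{t-s})^\mu{}_\nu\,\bm\Omega^{\nu\rho}\,\partial_\rho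 A(s)\big|_{\psi(s)},$$ where the integrand is integrable. In particular, if the perturbation vanishes before the initial time, i.e. the function $A(s)$ is zero on $\mathcal M$ for all $s<t_0$, then the integrand (taken to be zero for $s<t_0$) is integrable on $(-\infty,t]$ and $$\delta x^\mu(t)=-\int_{-\infty}^{t}ds\,(d\Phi_{t-s})^\mu{}_\nu\,\bm\Omega^{\nu\rho}\,\partial_\rho A(s)\big|_{\psi(s)}.$$ -/

import Mathlib

open Set Filter Topology MeasureTheory Manifold
open scoped ContDiff InnerProductSpace LinearAlgebra.Projectivization

noncomputable section

/-! ### Pseudo-inverse of an antisymmetric form with respect to a metric -/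

section PseudoInverse

variable {T : Type*} [AddCommGroup T] [Module ℝ T]

/-- `X` is the value at the covector `α` of the pseudo-inverse, with respect to the metric `g`, of
the antisymmetric form `w`: `X` is `g`-orthogonal to `ker w`, and `w u X = α u` for all `u` that are
`g`-orthogonal to `ker w`.  In indices: `X^μ = Ω^{μν} α_ν`, with `Ω^{μσ} w_{σν} = δ^μ_ν` if `w` is
non-degenerate, and `Ω` the inverse of `w` on `(ker w)^⊥` and zero on `ker w` in general. -/
def IsPseudoInverseAt (g w : LinearMap.BilinForm ℝ T) (α : Module.Dual ℝ T) (X : T) : Prop :=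
  (∀ v ∈ LinearMap.ker w, g v X = 0) ∧
    ∀ u : T, (∀ v ∈ LinearMap.ker w, g v u = 0) → w u X = α u

theorem existsUnique_isPseudoInverseAt [FiniteDimensional ℝ T] (g w : LinearMap.BilinForm ℝ T)
    (hsymm : ∀ u v, g u v = g v u) (hpos : ∀ u, u ≠ 0 → 0 < g u u)
    (hw : ∀ u v, w u v = - w v u) (α : Module.Dual ℝ T) :
    ∃! X : T, IsPseudoInverseAt g w α X := by
  have hrefl : g.IsRefl := fun u v h => by rw [hsymm]; exact h
  have hzero : ∀ u, g u u = 0 → u = 0 := fun u h => by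
    by_contra hu
    exact (hpos u hu).ne' h
  set D : Submodule ℝ T := LinearMap.ker w with hD
  set P : Submodule ℝ T := g.orthogonal D with hP
  have hmem : ∀ u, u ∈ P ↔ ∀ v ∈ D, g v u = 0 := fun u => by
    rw [hP, LinearMap.BilinForm.mem_orthogonal_iff]
  have hcompl : IsCompl D P := by
    rw [hP, LinearMap.BilinForm.isCompl_orthogonal_iff_disjoint hrefl, Submodule.disjoint_def]
    intro u hu hu'
    exact hzero u ((hmem u).1 hu' u hu)
  let L : P →ₗ[ℝ] Module.Dual ℝ P := (w.flip.domRestrict₁₂ P P)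
  have hL : ∀ X u : P, L X u = w u X := fun X u => rfl
  have hinj : Function.Injective L := by
    rw [injective_iff_map_eq_zero]
    intro X hX
    have hXD : (X : T) ∈ D := by
      rw [hD, LinearMap.mem_ker]
      ext u
      obtain ⟨d, hd, p, hp, rfl⟩ := Submodule.mem_sup.1
        (hcompl.sup_eq_top ▸ Submodule.mem_top : u ∈ D ⊔ P)
      have h1 : w d (X : T) = 0 := by
        rw [LinearMap.mem_ker.1 hd]; rfl
      have h2 : w p (X : T) = 0 := by
        have := LinearMap.congr_fun hX ⟨p, hp⟩
        exact this
      rw [map_add, hw _ d, hw _ p, h1, h2]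
      simp
    exact Subtype.ext (hzero X ((hmem X).1 X.2 X hXD))
  have hsurj : Function.Surjective L :=
    (LinearMap.injective_iff_surjective_of_finrank_eq_finrank
      (Subspace.dual_finrank_eq (K := ℝ) (V := P)).symm).1 hinj
  obtain ⟨X, hX⟩ := hsurj (α.domRestrict P)
  refine ⟨X, ⟨(hmem X).1 X.2, fun u hu => ?_⟩, ?_⟩
  · exact LinearMap.congr_fun hX ⟨u, (hmem u).2 hu⟩
  · rintro Y ⟨hY1, hY2⟩
    have : L ⟨Y, (hmem Y).2 hY1⟩ = L X := by
      rw [hX]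
      ext u
      exact hY2 u ((hmem u).1 u.2)
    exact congrArg Subtype.val (hinj this)

open Classical in
/-- The pseudo-inverse `α ↦ Ω α`, that is `(Ω α)^μ = Ω^{μν} α_ν`. By
`existsUnique_isPseudoInverseAt` it exists and is unique whenever `g` is a metric and `w` is
antisymmetric, so that the default value is never used below. -/
def pseudoInverse (g w : LinearMap.BilinForm ℝ T) (α : Module.Dual ℝ T) : T :=
  if h : ∃ X, IsPseudoInverseAt g w α X then h.choose else 0

end PseudoInverse

section Variational

variable {H : Type*} [NormedAddCommGroup H] [InnerProductSpace ℂ H]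

/-! ### Hilbert space: the projector onto `ψ^⊥`, expectation values -/

/-- `ℚ_ψ w = w - (⟨ψ|w⟩ / ⟨ψ|ψ⟩) ψ`. -/
def projPerp (ψ : H) : H →ₗ[ℂ] H where
  toFun w := w - (⟪ψ, w⟫_ℂ / ⟪ψ, ψ⟫_ℂ) • ψ
  map_add' u w := by rw [inner_add_right, add_div, add_smul]; abel
  map_smul' c w := by
    rw [inner_smul_right, RingHom.id_apply, smul_sub, smul_smul, mul_div_assoc]

open Classical in
/-- The expectation value `⟨ψ|A|ψ⟩ / ⟨ψ|ψ⟩` of a (possibly unbounded) operator in the state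
`p = [ψ]` of projective Hilbert space. It is set to `0` if `ψ` is not in the domain of `A`. For a
Hermitian operator `⟨ψ|A|ψ⟩` is real. -/
def expectation (A : H →ₗ.[ℂ] H) (p : ℙ ℂ H) : ℝ :=
  if h : p.rep ∈ A.domain then (⟪p.rep, A ⟨p.rep, h⟩⟫_ℂ).re / ‖p.rep‖ ^ 2 else 0

/-! ### Variational manifolds -/

variable {E : Type*} [NormedAddCommGroup E] [NormedSpace ℝ E]
  {M : Type*} [TopologicalSpace M] [ChartedSpace E M]

/-- `φ` is a smooth choice of representatives `|ψ(y)⟩ = φ y ∈ H ∖ {0}` of the states `state y`, for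
`y` near `x`. -/
def IsLift (state : M → ℙ ℂ H) (φ : M → H) (x : M) : Prop :=
  ∀ᶠ y in 𝓝 x, ContMDiffAt 𝓘(ℝ, E) 𝓘(ℝ, H) ∞ φ y ∧
    ∃ h : φ y ≠ 0, Projectivization.mk ℂ (φ y) h = state y

/-- The frame `T_x M → H`, `u ↦ u^μ |V_μ⟩`, where `|V_μ⟩ = ℚ_ψ ∂_μ |ψ⟩` and `|ψ(y)⟩ = φ y`. -/
def frame (φ : M → H) (x : M) : TangentSpace 𝓘(ℝ, E) x →ₗ[ℝ] H :=
  ((projPerp (φ x)).restrictScalars ℝ).comp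
    (mfderiv 𝓘(ℝ, E) 𝓘(ℝ, H) φ x : TangentSpace 𝓘(ℝ, E) x →L[ℝ] H).toLinearMap

variable (H E M) in
/-- A variational manifold: a real manifold `M` with a smooth immersion into the projective Hilbert
space `ℙ ℂ H`. Smoothness into `ℙ ℂ H` is expressed by local smooth representatives. The tangent
space of `ℙ ℂ H` at `[ψ]` is `ψ^⊥`, so that being an immersion says that the `|V_μ⟩` are linearly
independent over `ℝ`. A submanifold of `ℙ ℂ H` is the case in which `state` is the inclusion. -/
structure VariationalManifold where
  state : M → ℙ ℂ H
  exists_lift : ∀ x, ∃ φ : M → H, IsLift (E := E) state φ x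
  immersion : ∀ x (φ : M → H), IsLift (E := E) state φ x →
    Function.Injective (frame (E := E) φ x)

namespace VariationalManifold

variable (V : VariationalManifold H E M)

/-- A representative near `x`; the structures below do not depend on which one is chosen. -/
def lift (x : M) : M → H := (V.exists_lift x).choose

/-- The restricted metric `g_{μν} = 2 Re⟨V_μ|V_ν⟩ / ⟨ψ|ψ⟩`. -/
def metric (x : M) : LinearMap.BilinForm ℝ (TangentSpace 𝓘(ℝ, E) x) :=
  LinearMap.mk₂ ℝ
    (fun u v => 2 * (⟪frame (V.lift x) x u, frame (V.lift x) x v⟫_ℂ).re / ‖V.lift x x‖ ^ 2)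
    (fun u u' v => by simp only [map_add, inner_add_left, Complex.add_re]; ring)
    (fun c u v => by
      simp only [map_smul, inner_smul_left_eq_smul, Complex.real_smul,
        Complex.re_ofReal_mul, smul_eq_mul]; ring)
    (fun u v v' => by simp only [map_add, inner_add_right, Complex.add_re]; ring)
    (fun c u v => by
      simp only [map_smul, inner_smul_right_eq_smul, Complex.real_smul,
        Complex.re_ofReal_mul, smul_eq_mul]; ring)

/-- The restricted symplectic form `ω_{μν} = 2 Im⟨V_μ|V_ν⟩ / ⟨ψ|ψ⟩`. -/
def symp (x : M) : LinearMap.BilinForm ℝ (TangentSpace 𝓘(ℝ, E) x) :=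
  LinearMap.mk₂ ℝ
    (fun u v => 2 * (⟪frame (V.lift x) x u, frame (V.lift x) x v⟫_ℂ).im / ‖V.lift x x‖ ^ 2)
    (fun u u' v => by simp only [map_add, inner_add_left, Complex.add_im]; ring)
    (fun c u v => by
      simp only [map_smul, inner_smul_left_eq_smul, Complex.real_smul,
        Complex.im_ofReal_mul, smul_eq_mul]; ring)
    (fun u v v' => by simp only [map_add, inner_add_right, Complex.add_im]; ring)
    (fun c u v => by
      simp only [map_smul, inner_smul_right_eq_smul, Complex.real_smul,
        Complex.im_ofReal_mul, smul_eq_mul]; ring)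

/-- The bivector `α_ν ↦ Ω^{μν} α_ν`, where `Ω` is the (pseudo-)inverse of `ω` with respect to `g`. -/
def Omega (x : M) (α : Module.Dual ℝ (TangentSpace 𝓘(ℝ, E) x)) : TangentSpace 𝓘(ℝ, E) x :=
  pseudoInverse (V.metric x) (V.symp x) α

theorem existsUnique_omega [FiniteDimensional ℝ E] (x : M)
    (α : Module.Dual ℝ (TangentSpace 𝓘(ℝ, E) x)) :
    ∃! X, IsPseudoInverseAt (V.metric x) (V.symp x) α X := by
  have : FiniteDimensional ℝ (TangentSpace 𝓘(ℝ, E) x) := inferInstanceAs (FiniteDimensional ℝ E)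
  have hl : IsLift (E := E) V.state (V.lift x) x := (V.exists_lift x).choose_spec
  have hne : V.lift x x ≠ 0 := hl.self_of_nhds.2.1
  refine existsUnique_isPseudoInverseAt _ _ (fun u v => ?_) (fun u hu => ?_) (fun u v => ?_) α
  · simp only [metric, LinearMap.mk₂_apply]
    rw [← inner_conj_symm, Complex.conj_re]
  · simp only [metric, LinearMap.mk₂_apply]
    have h1 : frame (V.lift x) x u ≠ 0 := fun h =>
      hu (V.immersion x _ hl (by rw [h, map_zero]))
    have h2 : 0 < (⟪frame (V.lift x) x u, frame (V.lift x) x u⟫_ℂ).re := by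
      rw [← RCLike.re_eq_complex_re, inner_self_eq_norm_sq]
      exact pow_pos (norm_pos_iff.2 h1) 2
    have h3 : 0 < ‖V.lift x x‖ := norm_pos_iff.2 hne
    positivity
  · simp only [symp, LinearMap.mk₂_apply]
    rw [← inner_conj_symm, Complex.conj_im]
    ring

/-- The function `A(x)` on the manifold defined by the operator `A`. -/
def expect (A : H →ₗ.[ℂ] H) (x : M) : ℝ := expectation A (V.state x)

/-- Every representative of every state of the manifold is in the domain of `A`. -/
def InDomain (A : H →ₗ.[ℂ] H) : Prop := ∀ x, (V.state x).submodule ≤ A.domain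

/-- The covector `∂_ρ A` at `x`. -/
def dExpect (A : H →ₗ.[ℂ] H) (x : M) : Module.Dual ℝ (TangentSpace 𝓘(ℝ, E) x) :=
  (mfderiv 𝓘(ℝ, E) 𝓘(ℝ, ℝ) (V.expect A) x : TangentSpace 𝓘(ℝ, E) x →L[ℝ] ℝ).toLinearMap

/-- The evolution vector field of the Lagrangian action principle, `𝒳^μ = -Ω^{μν} ∂_ν ⟨A⟩`, for the
Hamiltonian `A`. -/
def lagrangianField (A : H →ₗ.[ℂ] H) (x : M) : TangentSpace 𝓘(ℝ, E) x :=
  -V.Omega x (V.dExpect A x)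

/-- `γ` is a projected real time evolution, on the time interval `[t₀, t₁]`, governed by the
(possibly time-dependent) Hamiltonian `A`. -/
def IsProjectedEvolution (A : ℝ → H →ₗ.[ℂ] H) (t₀ t₁ : ℝ) (γ : ℝ → M) : Prop :=
  ∀ s ∈ Icc t₀ t₁, HasMFDerivWithinAt 𝓘(ℝ, ℝ) 𝓘(ℝ, E) γ (Icc t₀ t₁) s
    ((1 : ℝ →L[ℝ] ℝ).smulRight (V.lagrangianField (A s) (γ s)))

open Classical in
/-- The flow `Φ_s` of the projected evolution with time-independent Hamiltonian `A`: `Φ_s(y)` is the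
state at time `s` of the evolution starting in `y` at time `0`, if there is one up to time `s`
(otherwise, by default, `y`). -/
def flow (A : H →ₗ.[ℂ] H) (s : ℝ) (y : M) : M :=
  if h : ∃ c : ℝ → M, c 0 = y ∧
      IsMIntegralCurveOn (I := 𝓘(ℝ, E)) c (V.lagrangianField A) (uIcc 0 s)
    then h.choose s else y

/-- The vector `(dΦ_{t-s})^μ_ν Ω^{νρ} ∂_ρ A(s)|_{γ(s)}`, where `Φ` is the flow of `H₀`. If `γ` is an
evolution under `H₀`, it is a vector in the tangent space at `Φ_{t-s}(γ(s)) = γ(t)`, which in Mathlib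
is a copy of the model space `E`. -/
def propagated (H₀ : H →ₗ.[ℂ] H) (A : ℝ → H →ₗ.[ℂ] H) (γ : ℝ → M) (t s : ℝ) : E :=
  (mfderiv 𝓘(ℝ, E) 𝓘(ℝ, E) (V.flow H₀ (t - s)) (γ s) : TangentSpace 𝓘(ℝ, E) (γ s) →L[ℝ] E)
    (V.Omega (γ s) (V.dExpect (A s) (γ s)))

/-- `δx` is the propagated perturbation at time `t` of the family `ψ_ε` of evolutions given by
`γ ε`: for every smooth choice of representatives, `|ψ_ε(t)⟩` is differentiable at `ε = 0` and
`δx^μ |V_μ⟩ = ℚ_ψ (d/dε) |ψ_ε(t)⟩` at `ε = 0`. -/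
def IsPropagatedPerturbation (γ : ℝ → ℝ → M) (t : ℝ) (δx : TangentSpace 𝓘(ℝ, E) (γ 0 t)) : Prop :=
  ∀ φ : M → H, IsLift (E := E) V.state φ (γ 0 t) →
    ∃ w : H, HasDerivAt (fun ε => φ (γ ε t)) w 0 ∧
      frame φ (γ 0 t) δx = projPerp (φ (γ 0 t)) w

end VariationalManifold

end Variational

end

/-! The theorem rests on two facts: the free field `-Ω dE` is `C¹` in charts near the free
trajectory, and a `C¹` field has a first-order perturbation theory, which is carried out in small
charts and continued along the trajectory.

Regularity. A pseudo-inverse is not a continuous function of the form in general, but it is where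
the rank is constant. If `N` parametrizes `ker w`, the square system `w(·, X) + g(·, N κ) = α`, `g(N
·, X) = 0` is invertible and the component `X` of its solution is the pseudo-inverse at `α`.
Inversion is smooth, so `Ω` inherits the regularity of `g`, `w` and `N`, and constant rank allows a
smooth `N` (`exists_contDiffAt_ker_parametrization`, `exists_contDiffAt_isPseudoInverseAt`). The
forms are `C¹` in a chart because they do not depend on the representatives (`metric_eq`,
`symp_eq`). As `Ω` is linear, the perturbed field is `X + ε Y` with `X` of class `C¹` and `Y = -Ω
dA(s)` jointly continuous.

Perturbation. Along a solution `x` of `x' = f x` let `S' = -S f'(x)` with `S b = 1`. For a solution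
`y` of `y' = f y + r` the linear terms cancel in the derivative of `S (y - x)`; what remains is `S
r` and a Taylor remainder, which Grönwall's inequality makes negligible
(`isLittleO_variation_of_constants`). With `r = 0` and a variable starting point this says that `S`
is the derivative of the flow; with `r = ε g` it gives the response `∫ S g`. The same `S` serves
both purposes, which is how `dΦ` enters the formula. Only continuity of `Y` is needed: perturbed
solutions are given, and their uniqueness plays no role.

Globalization. The flow is only local and the trajectory may leave every chart. It is cut into short
pieces, each in a ball of a chart that no evolution can leave during that time
(`chart_curve_mem_closedBall`); there the end point of a free evolution exists and is unique. The
pieces are joined by `Φ_{b-s} = Φ_{b-a} ∘ Φ_{a-s}` and the chain rule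
(`IsFlowBox.hasLinearResponse_of_le`). -/

section BorderedForm

/-! ### Smooth dependence of the pseudo-inverse on the forms, at constant rank. -/

variable {E K : Type*} [NormedAddCommGroup E] [NormedSpace ℝ E]
  [NormedAddCommGroup K] [NormedSpace ℝ K]

/-- The bordered linear system `(X, κ) ↦ (u ↦ w u X + g u (N κ), d ↦ g (N d) X)`. If `N` is a
parametrization of `ker w`, its solution with right hand side `(α, 0)` has as first component the
pseudo-inverse of `w` at `α`. -/
noncomputable def borderedMap (w g : E →L[ℝ] E →L[ℝ] ℝ) (N : K →L[ℝ] E) :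
    E × K →L[ℝ] (E →L[ℝ] ℝ) × (K →L[ℝ] ℝ) :=
  ((w.flip ∘L ContinuousLinearMap.fst ℝ E K) +
    ((g.flip ∘L N) ∘L ContinuousLinearMap.snd ℝ E K)).prod
    ((g ∘L N).flip ∘L ContinuousLinearMap.fst ℝ E K)

theorem borderedMap_fst_apply (w g : E →L[ℝ] E →L[ℝ] ℝ) (N : K →L[ℝ] E) (p : E × K) (u : E) :
    (borderedMap w g N p).1 u = w u p.1 + g u (N p.2) := rfl

theorem borderedMap_snd_apply (w g : E →L[ℝ] E →L[ℝ] ℝ) (N : K →L[ℝ] E) (p : E × K) (d : K) :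
    (borderedMap w g N p).2 d = g (N d) p.1 := rfl

/-- Testing the first equation with `u = N κ`, which lies in `ker w`, leaves `g (N κ) (N κ) = 0`.
Then `X` is in `ker w`, the range of `N`, and the second equation makes it `g`-orthogonal to itself.
-/
theorem borderedMap_injective {w g : E →L[ℝ] E →L[ℝ] ℝ} {N : K →L[ℝ] E}
    (hw : ∀ u v, w u v = - w v u) (hpos : ∀ u, u ≠ 0 → 0 < g u u)
    (hN : Function.Injective N) (hran : ∀ v, w v = 0 ↔ ∃ d, N d = v) :
    Function.Injective (borderedMap w g N) := by
  have hzero : ∀ u, g u u = 0 → u = 0 := fun u h => by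
    by_contra hu
    exact (hpos u hu).ne' h
  rw [injective_iff_map_eq_zero]
  rintro ⟨X, κ⟩ h
  have h1 : ∀ u, w u X + g u (N κ) = 0 := fun u => by
    rw [← borderedMap_fst_apply w g N (X, κ) u, h]; rfl
  have h2 : ∀ d, g (N d) X = 0 := fun d => by
    rw [← borderedMap_snd_apply w g N (X, κ) d, h]; rfl
  have hκ : N κ = 0 := by
    apply hzero
    have := h1 (N κ)
    rwa [(hran _).2 ⟨κ, rfl⟩, zero_apply, zero_add] at this
  have hX : w X = 0 := by
    ext u
    have := h1 u
    rw [hκ, map_zero, add_zero] at this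
    rw [hw, this]
    simp
  obtain ⟨d, hd⟩ := (hran X).1 hX
  have hX0 : X = 0 := hzero X (by simpa [hd] using h2 d)
  have hκ0 : κ = 0 := hN (by rw [hκ, map_zero])
  rw [hX0, hκ0]; rfl

theorem ContDiffAt.clm_flip {F G : Type*} [NormedAddCommGroup F] [NormedSpace ℝ F]
    [NormedAddCommGroup G] [NormedSpace ℝ G] {n : WithTop ℕ∞} {x : F}
    {f : F → G →L[ℝ] E →L[ℝ] ℝ} (hf : ContDiffAt ℝ n f x) :
    ContDiffAt ℝ n (fun y => (f y).flip) x :=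
  have hT : ContDiff ℝ n (fun L : G →L[ℝ] E →L[ℝ] ℝ => L.flip) := by
    have h : IsBoundedLinearMap ℝ (fun L : G →L[ℝ] E →L[ℝ] ℝ => L.flip) :=
      IsLinearMap.with_bound ⟨fun _ _ => rfl, fun _ _ => rfl⟩ 1 fun L => by
        rw [one_mul, ContinuousLinearMap.opNorm_flip]
    exact h.contDiff
  hT.contDiffAt.comp x hf

theorem contDiffAt_borderedMap {F : Type*} [NormedAddCommGroup F] [NormedSpace ℝ F]
    {n : WithTop ℕ∞} {x : F} {w g : F → E →L[ℝ] E →L[ℝ] ℝ} {N : F → K →L[ℝ] E}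
    (hw : ContDiffAt ℝ n w x) (hg : ContDiffAt ℝ n g x) (hN : ContDiffAt ℝ n N x) :
    ContDiffAt ℝ n (fun y => borderedMap (w y) (g y) (N y)) x := by
  have h1 : ContDiffAt ℝ n (fun y => ((w y).flip ∘L ContinuousLinearMap.fst ℝ E K) +
      (((g y).flip ∘L N y) ∘L ContinuousLinearMap.snd ℝ E K)) x :=
    (hw.clm_flip.clm_comp contDiffAt_const).add
      ((hg.clm_flip.clm_comp hN).clm_comp contDiffAt_const)
  have h2 : ContDiffAt ℝ n (fun y => (g y ∘L N y).flip ∘L ContinuousLinearMap.fst ℝ E K) x :=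
    (hg.clm_comp hN).clm_flip.clm_comp contDiffAt_const
  have h : (fun y => borderedMap (w y) (g y) (N y)) = fun y =>
      ContinuousLinearMap.inl ℝ (E →L[ℝ] ℝ) (K →L[ℝ] ℝ) ∘L
        ((w y).flip ∘L ContinuousLinearMap.fst ℝ E K +
          ((g y).flip ∘L N y) ∘L ContinuousLinearMap.snd ℝ E K) +
      ContinuousLinearMap.inr ℝ (E →L[ℝ] ℝ) (K →L[ℝ] ℝ) ∘L
        ((g y ∘L N y).flip ∘L ContinuousLinearMap.fst ℝ E K) := by
    funext y
    refine ContinuousLinearMap.ext fun p => Prod.ext ?_ ?_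
    · exact (add_zero _).symm
    · exact (zero_add _).symm
  rw [h]
  exact (contDiffAt_const.clm_comp h1).add (contDiffAt_const.clm_comp h2)

theorem finrank_continuousDual (G : Type*) [NormedAddCommGroup G] [NormedSpace ℝ G]
    [FiniteDimensional ℝ G] : Module.finrank ℝ (G →L[ℝ] ℝ) = Module.finrank ℝ G := by
  rw [← (LinearMap.toContinuousLinearMap (𝕜 := ℝ) (E := G) (F' := ℝ)).finrank_eq]
  exact Subspace.dual_finrank_eq

theorem borderedMap_exists_equiv [FiniteDimensional ℝ E] [FiniteDimensional ℝ K]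
    {w g : E →L[ℝ] E →L[ℝ] ℝ} {N : K →L[ℝ] E}
    (h : Function.Injective (borderedMap w g N)) :
    ∃ e : (E × K) ≃L[ℝ] (E →L[ℝ] ℝ) × (K →L[ℝ] ℝ), (e : _ →L[ℝ] _) = borderedMap w g N := by
  have hf : Module.finrank ℝ (E × K) = Module.finrank ℝ ((E →L[ℝ] ℝ) × (K →L[ℝ] ℝ)) := by
    rw [Module.finrank_prod, Module.finrank_prod, finrank_continuousDual, finrank_continuousDual]
  let l : (E × K) ≃ₗ[ℝ] (E →L[ℝ] ℝ) × (K →L[ℝ] ℝ) :=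
    LinearEquiv.ofInjectiveOfFinrankEq (borderedMap w g N).toLinearMap h hf
  refine ⟨l.toContinuousLinearEquiv, ?_⟩
  ext x <;> rfl

variable [FiniteDimensional ℝ E] [FiniteDimensional ℝ K]

/-- Near a parameter at which the rank of `w` does not jump, a parametrization of `ker w` at that
parameter extends to a `C^n` family of parametrizations. -/
theorem exists_contDiffAt_ker_parametrization {F : Type*} [NormedAddCommGroup F] [NormedSpace ℝ F]
    {n : WithTop ℕ∞} {x₀ : F} {w : F → E →L[ℝ] E →L[ℝ] ℝ} {g₀ : E →L[ℝ] E →L[ℝ] ℝ}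
    (hw : ContDiffAt ℝ n w x₀)
    (hanti : ∀ᶠ x in 𝓝 x₀, ∀ u v, w x u v = - w x v u) (hpos : ∀ u, u ≠ 0 → 0 < g₀ u u)
    (ι : K →L[ℝ] E) (hι : Function.Injective ι) (hran : ∀ v, w x₀ v = 0 ↔ ∃ d, ι d = v)
    (hrank : ∀ᶠ x in 𝓝 x₀, Module.finrank ℝ (LinearMap.ker (w x).toLinearMap) =
      Module.finrank ℝ K) :
    ∃ N : F → K →L[ℝ] E, ContDiffAt ℝ n N x₀ ∧
      ∀ᶠ x in 𝓝 x₀, Function.Injective (N x) ∧ ∀ v, w x v = 0 ↔ ∃ d, N x d = v := by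
  -- `J` is the Gram form of `ι`. It identifies `K` with its dual, so that the solutions constructed
  -- below are indexed by `K`.
  let J : K →L[ℝ] K →L[ℝ] ℝ := (g₀ ∘L ι).flip ∘L ι
  have hJ : ∀ d d' : K, J d d' = g₀ (ι d') (ι d) := fun d d' => rfl
  -- The metric and the border are frozen at `x₀` and only `w` varies. `C x₀` is invertible, hence
  -- so is `C x` for nearby `x`, and no knowledge of `ker (w x)` is needed for this.
  let C : F → E × K →L[ℝ] (E →L[ℝ] ℝ) × (K →L[ℝ] ℝ) := fun x => borderedMap (w x) g₀ ι
  have hC : ContDiffAt ℝ n C x₀ := contDiffAt_borderedMap hw contDiffAt_const contDiffAt_const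
  obtain ⟨e, he⟩ := borderedMap_exists_equiv
    (borderedMap_injective (N := ι) hanti.self_of_nhds hpos hι hran)
  have hinv : ContDiffAt ℝ n (fun x => ContinuousLinearMap.inverse (C x)) x₀ := by
    have h := contDiffAt_map_inverse (n := n) e
    rw [he] at h
    exact h.comp x₀ hC
  have hev : ∀ᶠ x in 𝓝 x₀, C x ∈ range ((↑) :
      ((E × K) ≃L[ℝ] (E →L[ℝ] ℝ) × (K →L[ℝ] ℝ)) → _) := by
    apply hC.continuousAt.eventually_mem
    change _ ∈ 𝓝 (borderedMap (w x₀) g₀ ι)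
    rw [← he]
    exact ContinuousLinearEquiv.nhds e
  refine ⟨fun x => (ContinuousLinearMap.fst ℝ E K ∘L ContinuousLinearMap.inverse (C x)) ∘L
    (ContinuousLinearMap.inr ℝ (E →L[ℝ] ℝ) (K →L[ℝ] ℝ) ∘L J),
    (contDiffAt_const.clm_comp hinv).clm_comp contDiffAt_const, ?_⟩
  filter_upwards [hev, hanti, hrank] with x ⟨c, hc⟩ ha hr
  have hN : ∀ d, ((ContinuousLinearMap.fst ℝ E K ∘L ContinuousLinearMap.inverse (C x)) ∘L
    (ContinuousLinearMap.inr ℝ (E →L[ℝ] ℝ) (K →L[ℝ] ℝ) ∘L J)) d = (c.symm (0, J d)).1 := by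
    intro d
    rw [← hc, ContinuousLinearMap.inverse_equiv]
    rfl
  have hcapp : ∀ p, c p = borderedMap (w x) g₀ ι p := fun p => by
    change (c : E × K →L[ℝ] (E →L[ℝ] ℝ) × (K →L[ℝ] ℝ)) p = _
    rw [hc]
  -- `C x` maps `(v, 0)` with `v ∈ ker (w x)` to `(0, L v)`, so `L` is injective; equality of
  -- dimensions, the rank hypothesis, makes it bijective. Therefore every solution with right hand
  -- side `(0, J d)` is of the form `(v, 0)` with `v` in the kernel.
  let L : LinearMap.ker (w x).toLinearMap →ₗ[ℝ] (K →L[ℝ] ℝ) :=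
    ((g₀ ∘L ι).flip).toLinearMap ∘ₗ (LinearMap.ker (w x).toLinearMap).subtype
  have hcv : ∀ v : LinearMap.ker (w x).toLinearMap, c ((v : E), 0) = (0, L v) := by
    intro v
    have hv : w x v = 0 := v.2
    rw [hcapp]
    refine Prod.ext ?_ ?_
    · ext u
      rw [borderedMap_fst_apply, ha, hv]
      simp
    · ext d
      rw [borderedMap_snd_apply]
      rfl
  have hLinj : Function.Injective L := by
    rw [injective_iff_map_eq_zero]
    intro v hv
    have h1 : c ((v : E), 0) = 0 := by rw [hcv, hv]; rfl
    have h2 := congrArg Prod.fst ((map_eq_zero_iff c c.injective).1 h1)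
    exact Subtype.ext h2
  have hLsurj : Function.Surjective L :=
    (LinearMap.injective_iff_surjective_of_finrank_eq_finrank
      (by rw [hr, finrank_continuousDual])).1 hLinj
  have hNv : ∀ d, ∃ v : LinearMap.ker (w x).toLinearMap, L v = J d ∧ (c.symm (0, J d)).1 = v := by
    intro d
    obtain ⟨v, hv⟩ := hLsurj (J d)
    refine ⟨v, hv, ?_⟩
    rw [← hv, ← hcv, c.symm_apply_apply]
  have hJinj : Function.Injective J := by
    rw [injective_iff_map_eq_zero]
    intro d hd
    by_contra hd0
    have := hpos (ι d) (fun h => hd0 (hι (by rw [h, map_zero])))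
    rw [← hJ, hd] at this
    exact lt_irrefl _ this
  have hJsurj : Function.Surjective J :=
    (LinearMap.injective_iff_surjective_of_finrank_eq_finrank
      (f := J.toLinearMap) (by rw [finrank_continuousDual])).1 hJinj
  constructor
  · rw [injective_iff_map_eq_zero]
    intro d hd
    rw [hN] at hd
    obtain ⟨v, hv, hv'⟩ := hNv d
    have : v = 0 := Subtype.ext (hv'.symm.trans hd)
    rw [this, map_zero] at hv
    exact hJinj (by rw [← hv, map_zero])
  · intro v
    constructor
    · intro hv
      obtain ⟨d, hd⟩ := hJsurj (L ⟨v, hv⟩)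
      refine ⟨d, ?_⟩
      rw [hN, hd, ← hcv, c.symm_apply_apply]
    · rintro ⟨d, rfl⟩
      rw [hN]
      obtain ⟨v, -, hv'⟩ := hNv d
      rw [hv']
      exact v.2

/-- The pseudo-inverse of an antisymmetric form with respect to a metric is a `C^n` function of the
two forms, where the rank does not jump. -/
theorem exists_contDiffAt_isPseudoInverseAt {F : Type*} [NormedAddCommGroup F] [NormedSpace ℝ F]
    {n : WithTop ℕ∞} {x₀ : F} {g w : F → E →L[ℝ] E →L[ℝ] ℝ}
    (hg : ContDiffAt ℝ n g x₀) (hw : ContDiffAt ℝ n w x₀)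
    (hsymm : ∀ᶠ x in 𝓝 x₀, ∀ u v, g x u v = g x v u)
    (hpos : ∀ᶠ x in 𝓝 x₀, ∀ u, u ≠ 0 → 0 < g x u u)
    (hanti : ∀ᶠ x in 𝓝 x₀, ∀ u v, w x u v = - w x v u)
    (hrank : ∀ᶠ x in 𝓝 x₀, Module.finrank ℝ (LinearMap.ker (w x).toLinearMap) =
      Module.finrank ℝ (LinearMap.ker (w x₀).toLinearMap)) :
    ∃ O : F → (E →L[ℝ] ℝ) →L[ℝ] E, ContDiffAt ℝ n O x₀ ∧
      ∀ᶠ x in 𝓝 x₀, ∀ α : E →L[ℝ] ℝ, (∀ v, w x v = 0 → g x v (O x α) = 0) ∧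
        ∀ u, (∀ v, w x v = 0 → g x v u = 0) → w x u (O x α) = α u := by
  let K := Fin (Module.finrank ℝ (LinearMap.ker (w x₀).toLinearMap)) → ℝ
  let i : K ≃ₗ[ℝ] LinearMap.ker (w x₀).toLinearMap :=
    LinearEquiv.ofFinrankEq _ _ (by simp [K])
  let ι : K →L[ℝ] E :=
    LinearMap.toContinuousLinearMap ((LinearMap.ker (w x₀).toLinearMap).subtype ∘ₗ i.toLinearMap)
  obtain ⟨N, hN, hNev⟩ := exists_contDiffAt_ker_parametrization (K := K) hw hanti
    hpos.self_of_nhds ι (fun a b h => i.injective (Subtype.ext h))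
    (fun v => ⟨fun h => ⟨i.symm ⟨v, h⟩, by simp [ι]⟩, by rintro ⟨d, rfl⟩; exact (i d).2⟩)
    (by simpa [K] using hrank)
  -- Now both metric and border move with `x`. The second equation says that the solution is
  -- `g`-orthogonal to the kernel, and the term `g u (N κ)` of the first drops out for `u`
  -- orthogonal to the kernel.
  let B : F → E × K →L[ℝ] (E →L[ℝ] ℝ) × (K →L[ℝ] ℝ) := fun x => borderedMap (w x) (g x) (N x)
  have hinj : ∀ᶠ x in 𝓝 x₀, Function.Injective (B x) := by
    filter_upwards [hpos, hanti, hNev] with x h1 h2 h3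
    exact borderedMap_injective h2 h1 h3.1 h3.2
  obtain ⟨e, he⟩ := borderedMap_exists_equiv hinj.self_of_nhds
  have hinv : ContDiffAt ℝ n (fun x => ContinuousLinearMap.inverse (B x)) x₀ := by
    have h := contDiffAt_map_inverse (n := n) e
    rw [he] at h
    exact h.comp x₀ (contDiffAt_borderedMap hw hg hN)
  refine ⟨fun x => (ContinuousLinearMap.fst ℝ E K ∘L ContinuousLinearMap.inverse (B x)) ∘L
    ContinuousLinearMap.inl ℝ (E →L[ℝ] ℝ) (K →L[ℝ] ℝ),
    (contDiffAt_const.clm_comp hinv).clm_comp contDiffAt_const, ?_⟩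
  filter_upwards [hinj, hNev, hsymm] with x hx hNx hgx α
  obtain ⟨c, hc⟩ := borderedMap_exists_equiv hx
  set p := c.symm (α, 0) with hp
  have hO : ((ContinuousLinearMap.fst ℝ E K ∘L ContinuousLinearMap.inverse (B x)) ∘L
    ContinuousLinearMap.inl ℝ (E →L[ℝ] ℝ) (K →L[ℝ] ℝ)) α = p.1 := by
    simp only [B]
    rw [← hc, ContinuousLinearMap.inverse_equiv]
    rfl
  have hBp : borderedMap (w x) (g x) (N x) p = (α, 0) := by
    rw [← hc]
    exact c.apply_symm_apply _
  rw [hO]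
  constructor
  · intro v hv
    obtain ⟨d, rfl⟩ := (hNx.2 v).1 hv
    rw [← borderedMap_snd_apply (w x), hBp]
    rfl
  · intro u hu
    have h1 := borderedMap_fst_apply (w x) (g x) (N x) p u
    rw [hBp] at h1
    rw [hgx, hu _ ((hNx.2 _).2 ⟨_, rfl⟩), add_zero] at h1
    exact h1.symm

end BorderedForm

/-! ### First-order perturbation theory of ordinary differential equations in a normed space. -/

section OrdinaryDifferentialEquations

open scoped NNReal
open Metric Asymptotics

variable {E : Type*} [NormedAddCommGroup E] [NormedSpace ℝ E]

theorem HasDerivWithinAt.Icc_to_Ici {x : ℝ → E} {x' : E} {a b s : ℝ} (hs : s ∈ Ico a b)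
    (h : HasDerivWithinAt x x' (Icc a b) s) : HasDerivWithinAt x x' (Ici s) s :=
  h.mono_of_mem_nhdsWithin (Icc_mem_nhdsGE_of_mem hs)

/-- Grönwall's bound is homogeneous in the initial error and the error of the field, so deviations
can be bounded by a fixed multiple of `ρ`. -/
theorem gronwallBound_self_mul (ρ K x : ℝ) : gronwallBound ρ K ρ x = ρ * gronwallBound 1 K 1 x := by
  unfold gronwallBound
  split_ifs <;> ring

/-- Picard–Lindelöf for an autonomous field, with the solution confined to the ball. -/
theorem exists_hasDerivWithinAt_mem_closedBall [CompleteSpace E] {f : E → E} {x₀ y : E}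
    {r C a b : ℝ} {K : ℝ≥0} (hab : a ≤ b) (hr : 0 ≤ r) (hC : 0 ≤ C)
    (hf : LipschitzOnWith K f (closedBall x₀ r)) (hfC : ∀ z ∈ closedBall x₀ r, ‖f z‖ ≤ C)
    (hy : y ∈ closedBall x₀ (r / 2)) (hCr : C * (b - a) ≤ r / 2) :
    ∃ c : ℝ → E, c a = y ∧ ∀ s ∈ Icc a b,
      HasDerivWithinAt c (f (c s)) (Icc a b) s ∧ c s ∈ closedBall x₀ r := by
  lift r to ℝ≥0 using hr
  lift C to ℝ≥0 using hC
  let t₀ : Icc a b := ⟨a, left_mem_Icc.2 hab⟩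
  have hpl : IsPicardLindelof (fun _ => f) t₀ x₀ r (r / 2) C K := by
    refine IsPicardLindelof.of_time_independent hfC hf ?_
    change (C : ℝ) * max (b - a) (a - a) ≤ r - ((r / 2 : ℝ≥0) : ℝ)
    rw [sub_self, max_eq_left (sub_nonneg.2 hab)]
    push_cast
    linarith
  replace hy : y ∈ closedBall x₀ ((r / 2 : ℝ≥0) : ℝ) := by
    push_cast
    exact hy
  -- The fixed point of the Picard iteration is used directly, because confinement to the ball is
  -- built into the space in which it lives.
  obtain ⟨α, hα⟩ := ODE.FunSpace.exists_isFixedPt_next hpl hy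
  refine ⟨α.compProj, ?_, fun t ht => ⟨?_, α.compProj_mem_closedBall hpl.mul_max_le⟩⟩
  · change α.compProj t₀ = y
    rw [ODE.FunSpace.compProj_val, ← hα, ODE.FunSpace.next_apply₀]
  apply ODE.hasDerivWithinAt_picard_Icc t₀.2 hpl.continuousOn_uncurry
    α.continuous_compProj.continuousOn (fun _ ht' => α.compProj_mem_closedBall hpl.mul_max_le)
    y ht |>.congr_of_mem _ ht
  intro t' ht'
  nth_rw 1 [← hα]
  rw [ODE.FunSpace.compProj_of_mem ht', ODE.FunSpace.next_apply]

/-- The resolvent of the adjoint linear equation `S' = -S A`, on a short time interval. -/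
theorem exists_adjoint_resolvent [CompleteSpace E] {A : ℝ → E →L[ℝ] E} {a b : ℝ} {K : ℝ≥0}
    (hab : a ≤ b) (hA : ContinuousOn A (Icc a b)) (hK : ∀ s ∈ Icc a b, ‖A s‖ ≤ K)
    (hsmall : 2 * K * (b - a) ≤ 1) :
    ∃ S : ℝ → E →L[ℝ] E, S b = ContinuousLinearMap.id ℝ E ∧
      ∀ s ∈ Icc a b, HasDerivWithinAt S (-(S s ∘L A s)) (Icc a b) s := by
  let t₀ : Icc a b := ⟨b, right_mem_Icc.2 hab⟩
  -- The equation is solved backwards from `b`, in the unit ball about the identity. There `‖S‖ ≤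
  -- 2`, so the speed is at most `2 K`, and `2 K (b - a) ≤ 1` is what the ball of radius `1`
  -- permits.
  have hpl : IsPicardLindelof (fun s (S : E →L[ℝ] E) => -(S ∘L A s)) t₀
      (ContinuousLinearMap.id ℝ E) 1 0 (2 * K) K := by
    refine ⟨fun s hs => LipschitzOnWith.of_dist_le_mul fun S _ T _ => ?_, fun S _ => ?_,
      fun s hs S hS => ?_, ?_⟩
    · rw [dist_neg_neg, dist_eq_norm, dist_eq_norm, ← ContinuousLinearMap.sub_comp, mul_comm]
      exact (ContinuousLinearMap.opNorm_comp_le _ _).trans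
        (mul_le_mul_of_nonneg_left (hK s hs) (norm_nonneg _))
    · exact (continuousOn_const.clm_comp hA).neg
    · rw [norm_neg]
      have h1 : ‖S‖ ≤ 2 := by
        have h2 : ‖S - ContinuousLinearMap.id ℝ E‖ ≤ 1 := by
          simpa [dist_eq_norm] using hS
        have h3 : ‖S‖ ≤ ‖S - ContinuousLinearMap.id ℝ E‖ + ‖ContinuousLinearMap.id ℝ E‖ := by
          simpa using norm_add_le (S - ContinuousLinearMap.id ℝ E) (ContinuousLinearMap.id ℝ E)
        linarith [ContinuousLinearMap.norm_id_le (𝕜 := ℝ) (E := E)]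
      push_cast
      exact (ContinuousLinearMap.opNorm_comp_le _ _).trans
        (mul_le_mul h1 (hK s hs) (norm_nonneg _) zero_le_two)
    · change ((2 * K : ℝ≥0) : ℝ) * max (b - b) (b - a) ≤ ((1 : ℝ≥0) : ℝ) - ((0 : ℝ≥0) : ℝ)
      rw [sub_self, max_eq_right (sub_nonneg.2 hab)]
      push_cast
      linarith
  obtain ⟨S, hS0, hS⟩ := hpl.exists_eq_forall_mem_Icc_hasDerivWithinAt₀
  exact ⟨S, hS0, hS⟩

/-- First order expansion of a `C¹` map, uniformly on a compact convex set. -/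
theorem exists_delta_norm_sub_sub_le {f : E → E} {f' : E → E →L[ℝ] E} {B : Set E}
    (hB : IsCompact B) (hBc : Convex ℝ B) (hf : ∀ z ∈ B, HasFDerivWithinAt f (f' z) B z)
    (hf' : ContinuousOn f' B) {η : ℝ} (hη : 0 < η) :
    ∃ δ > 0, ∀ z ∈ B, ∀ w ∈ B, ‖w - z‖ < δ → ‖f w - f z - f' z (w - z)‖ ≤ η * ‖w - z‖ := by
  have hu := hB.uniformContinuousOn_of_continuous hf'
  obtain ⟨δ, hδ, h⟩ := Metric.uniformContinuousOn_iff.1 hu η hη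
  refine ⟨δ, hδ, fun z hz w hw hzw => ?_⟩
  have hs : Convex ℝ (B ∩ ball z δ) := hBc.inter (convex_ball z δ)
  refine hs.norm_image_sub_le_of_norm_hasFDerivWithin_le'
    (fun x hx => (hf x hx.1).mono inter_subset_left) (fun x hx => ?_)
    ⟨hz, mem_ball_self hδ⟩ ⟨hw, by rwa [mem_ball, dist_eq_norm]⟩
  rw [← dist_eq_norm]
  exact (h x hx.1 z hz hx.2).le

/-- Grönwall's inequality for a perturbation of size `ρ` of both the field and the initial point. -/
theorem norm_sub_le_mul_gronwallBound {f : E → E} {B : Set E} {K : ℝ≥0} {x y r : ℝ → E}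
    {a b ρ : ℝ} (hf : LipschitzOnWith K f B)
    (hx : ∀ s ∈ Icc a b, HasDerivWithinAt x (f (x s)) (Icc a b) s) (hxB : ∀ s ∈ Icc a b, x s ∈ B)
    (hy : ∀ s ∈ Icc a b, HasDerivWithinAt y (f (y s) + r s) (Icc a b) s)
    (hyB : ∀ s ∈ Icc a b, y s ∈ B) (hρ : 0 ≤ ρ) (ha : ‖y a - x a‖ ≤ ρ)
    (hr : ∀ s ∈ Icc a b, ‖r s‖ ≤ ρ) :
    ∀ s ∈ Icc a b, ‖y s - x s‖ ≤ ρ * gronwallBound 1 K 1 (b - a) := by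
  intro s hs
  have h := dist_le_of_approx_trajectories_ODE_of_mem (v := fun _ => f) (s := fun _ => B)
    (K := K) (f := y) (g := x) (f' := fun s => f (y s) + r s) (g' := fun s => f (x s))
    (εf := ρ) (εg := 0) (δ := ρ) (fun _ _ => hf)
    (fun t ht => (hy t ht).continuousWithinAt)
    (fun t ht => (hy t (Ico_subset_Icc_self ht)).Icc_to_Ici ht)
    (fun t ht => by simpa [dist_eq_norm] using hr t (Ico_subset_Icc_self ht))
    (fun t ht => hyB t (Ico_subset_Icc_self ht))
    (fun t ht => (hx t ht).continuousWithinAt)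
    (fun t ht => (hx t (Ico_subset_Icc_self ht)).Icc_to_Ici ht)
    (fun t ht => by simp)
    (fun t ht => hxB t (Ico_subset_Icc_self ht)) (by rwa [dist_eq_norm]) s hs
  rw [dist_eq_norm, add_zero, gronwallBound_self_mul] at h
  refine h.trans (mul_le_mul_of_nonneg_left ?_ hρ)
  exact gronwallBound_mono zero_le_one zero_le_one K.2 (by linarith [hs.2])

theorem exists_lipschitzOnWith_of_continuousOn_deriv {f : E → E} {f' : E → E →L[ℝ] E} {B : Set E}
    (hB : IsCompact B) (hBc : Convex ℝ B) (hf : ∀ z ∈ B, HasFDerivWithinAt f (f' z) B z)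
    (hf' : ContinuousOn f' B) : ∃ K : ℝ≥0, LipschitzOnWith K f B ∧ ∀ z ∈ B, ‖f' z‖ ≤ K := by
  obtain ⟨C, hC⟩ := hB.exists_bound_of_continuousOn hf'
  have h : ∀ z ∈ B, ‖f' z‖₊ ≤ C.toNNReal := fun z hz => by
    rw [← NNReal.coe_le_coe, coe_nnnorm]
    exact (hC z hz).trans (Real.le_coe_toNNReal C)
  exact ⟨C.toNNReal, hBc.lipschitzOnWith_of_nnnorm_hasFDerivWithin_le hf h, fun z hz => h z hz⟩

/-- Variation of constants: the response of the solution `x` to a perturbation of its initial point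
and to a source, to first order, in terms of the adjoint resolvent. -/
theorem isLittleO_variation_of_constants [CompleteSpace E] {ι : Type*} {l : Filter ι}
    {f : E → E} {f' : E → E →L[ℝ] E} {B : Set E} (hB : IsCompact B) (hBc : Convex ℝ B)
    (hf : ∀ z ∈ B, HasFDerivWithinAt f (f' z) B z) (hf' : ContinuousOn f' B)
    {a b : ℝ} (hab : a ≤ b) {x : ℝ → E} {S : ℝ → E →L[ℝ] E} {y r : ι → ℝ → E} {ρ : ι → ℝ}
    (hx : ∀ s ∈ Icc a b, HasDerivWithinAt x (f (x s)) (Icc a b) s) (hxB : ∀ s ∈ Icc a b, x s ∈ B)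
    (hS : ∀ s ∈ Icc a b, HasDerivWithinAt S (-(S s ∘L f' (x s))) (Icc a b) s)
    (hy : ∀ᶠ i in l, ∀ s ∈ Icc a b,
      HasDerivWithinAt (y i) (f (y i s) + r i s) (Icc a b) s ∧ y i s ∈ B ∧ ‖r i s‖ ≤ ρ i)
    (hr : ∀ᶠ i in l, ContinuousOn (r i) (Icc a b))
    (hρ0 : ∀ i, 0 ≤ ρ i) (hya : ∀ᶠ i in l, ‖y i a - x a‖ ≤ ρ i) (hρ : Tendsto ρ l (𝓝 0)) :
    (fun i => S b (y i b - x b) - S a (y i a - x a) - ∫ s in a..b, S s (r i s)) =o[l] ρ := by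
  obtain ⟨K, hK, -⟩ := exists_lipschitzOnWith_of_continuousOn_deriv hB hBc hf hf'
  have hxc : ContinuousOn x (Icc a b) := fun s hs => (hx s hs).continuousWithinAt
  have hSc : ContinuousOn S (Icc a b) := fun s hs => (hS s hs).continuousWithinAt
  have hfc : ContinuousOn f B := hK.continuousOn
  obtain ⟨C, hC⟩ := isCompact_Icc.exists_bound_of_continuousOn hSc
  set G := gronwallBound 1 K 1 (b - a) with hG
  have hG1 : 1 ≤ G := by
    refine (gronwallBound_x0 1 K 1).symm.le.trans ?_
    exact gronwallBound_mono zero_le_one zero_le_one K.2 (sub_nonneg.2 hab)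
  have hC0 : 0 ≤ C := (norm_nonneg _).trans (hC a (left_mem_Icc.2 hab))
  rw [isLittleO_iff]
  intro c hc
  have hden : 0 < C * G * (b - a) + 1 := by
    have := sub_nonneg.2 hab
    positivity
  -- Chosen so that `η * (C * G * (b - a)) ≤ c` in the final estimate; the `+ 1` keeps the
  -- denominator positive when `a = b`.
  set η := c / (C * G * (b - a) + 1) with hη
  have hη0 : 0 < η := div_pos hc hden
  obtain ⟨δ, hδ, hlin⟩ := exists_delta_norm_sub_sub_le hB hBc hf hf' hη0
  -- By Grönwall the deviation `y i - x` is at most `ρ i * G`; once this is below `δ`, the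
  -- linearization estimate applies at all times.
  have hρδ : ∀ᶠ i in l, ρ i * G < δ := by
    have h := hρ.mul_const G
    rw [zero_mul] at h
    exact h.eventually_lt_const hδ
  filter_upwards [hy, hr, hya, hρδ] with i hyi hri hyai hρi
  have hgr := norm_sub_le_mul_gronwallBound hK hx hxB (fun s hs => (hyi s hs).1)
    (fun s hs => (hyi s hs).2.1) (hρ0 i) hyai (fun s hs => (hyi s hs).2.2)
  have hyc : ContinuousOn (y i) (Icc a b) := fun s hs => (hyi s hs).1.continuousWithinAt
  let D : ℝ → E := fun s => S s (f (y i s) - f (x s) - f' (x s) (y i s - x s))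
  have hDc : ContinuousOn D (Icc a b) := by
    refine hSc.clm_apply (((hfc.comp hyc fun s hs => (hyi s hs).2.1).sub
      (hfc.comp hxc hxB)).sub ?_)
    exact (hf'.comp hxc hxB).clm_apply (hyc.sub hxc)
  have hSr : ContinuousOn (fun s => S s (r i s)) (Icc a b) := hSc.clm_apply hri
  -- The term `-S f'(x) (y - x)` from the derivative of `S` turns `S (f y - f x)` into the Taylor
  -- remainder `D`.
  have hderiv : ∀ s ∈ Icc a b, HasDerivWithinAt (fun s => S s (y i s - x s))
      (D s + S s (r i s)) (Icc a b) s := by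
    intro s hs
    have h := (hS s hs).clm_apply ((hyi s hs).1.sub (hx s hs))
    refine h.congr_deriv ?_
    simp only [D, Pi.sub_apply, neg_apply, ContinuousLinearMap.comp_apply, map_sub, map_add]
    abel
  have hint : ∫ s in a..b, (D s + S s (r i s)) = S b (y i b - x b) - S a (y i a - x a) := by
    refine intervalIntegral.integral_eq_sub_of_hasDeriv_right
      (f := fun s => S s (y i s - x s)) ?_ (fun s hs => ?_) ?_
    · rw [uIcc_of_le hab]
      exact fun s hs => (hderiv s hs).continuousWithinAt
    · rw [min_eq_left hab, max_eq_right hab] at hs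
      exact ((hderiv s (Ioo_subset_Icc_self hs)).Icc_to_Ici (Ioo_subset_Ico_self hs)).mono
        Ioi_subset_Ici_self
    · refine ContinuousOn.intervalIntegrable ?_
      rw [uIcc_of_le hab]
      exact hDc.add hSr
  have hDi : IntervalIntegrable D volume a b :=
    ContinuousOn.intervalIntegrable (by rwa [uIcc_of_le hab])
  have hSri : IntervalIntegrable (fun s => S s (r i s)) volume a b :=
    ContinuousOn.intervalIntegrable (by rwa [uIcc_of_le hab])
  rw [← hint, intervalIntegral.integral_add hDi hSri, add_sub_cancel_right]
  have hbound : ∀ s ∈ uIoc a b, ‖D s‖ ≤ C * (η * (ρ i * G)) := by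
    intro s hs
    rw [uIoc_of_le hab] at hs
    have hs' := Ioc_subset_Icc_self hs
    have h1 := hlin (x s) (hxB s hs') (y i s) (hyi s hs').2.1 ((hgr s hs').trans_lt hρi)
    refine ((S s).le_opNorm _).trans (mul_le_mul (hC s hs') (h1.trans ?_) (norm_nonneg _) hC0)
    exact mul_le_mul_of_nonneg_left (hgr s hs') hη0.le
  refine (intervalIntegral.norm_integral_le_of_norm_le_const hbound).trans ?_
  rw [abs_of_nonneg (sub_nonneg.2 hab), Real.norm_of_nonneg (hρ0 i)]
  have h2 : C * (η * (ρ i * G)) * (b - a) = η * (C * G * (b - a)) * ρ i := by ring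
  rw [h2]
  refine mul_le_mul_of_nonneg_right ?_ (hρ0 i)
  calc η * (C * G * (b - a)) ≤ η * (C * G * (b - a) + 1) := by gcongr; linarith
    _ = c := by rw [hη]; field_simp

/-- The time-`(b - a)` map of a `C¹` field is differentiable, and its derivative is the adjoint
resolvent. -/
theorem hasFDerivAt_endpoint [CompleteSpace E]
    {f : E → E} {f' : E → E →L[ℝ] E} {B : Set E} (hB : IsCompact B) (hBc : Convex ℝ B)
    (hf : ∀ z ∈ B, HasFDerivWithinAt f (f' z) B z) (hf' : ContinuousOn f' B)
    {a b : ℝ} (hab : a ≤ b) {x : ℝ → E} {S : ℝ → E →L[ℝ] E} {y : E → ℝ → E}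
    (hx : ∀ s ∈ Icc a b, HasDerivWithinAt x (f (x s)) (Icc a b) s) (hxB : ∀ s ∈ Icc a b, x s ∈ B)
    (hS : ∀ s ∈ Icc a b, HasDerivWithinAt S (-(S s ∘L f' (x s))) (Icc a b) s)
    (hSb : S b = ContinuousLinearMap.id ℝ E)
    (hy : ∀ᶠ z in 𝓝 (x a), y z a = z ∧ ∀ s ∈ Icc a b,
      HasDerivWithinAt (y z) (f (y z s)) (Icc a b) s ∧ y z s ∈ B)
    (hyx : y (x a) b = x b) :
    HasFDerivAt (fun z => y z b) (S a) (x a) := by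
  -- The family is indexed by the starting point `z` and has no source; its size is `‖z - x a‖`.
  have h := isLittleO_variation_of_constants (l := 𝓝 (x a)) (y := y) (r := fun _ _ => 0)
    (ρ := fun z => ‖z - x a‖) hB hBc hf hf' hab hx hxB hS
    (by
      filter_upwards [hy] with z hz s hs
      exact ⟨by simpa using (hz.2 s hs).1, (hz.2 s hs).2, by simp⟩)
    (Eventually.of_forall fun _ => continuousOn_const) (fun _ => norm_nonneg _)
    (by filter_upwards [hy] with z hz; rw [hz.1])
    (by
      have : Tendsto (fun z => ‖z - x a‖) (𝓝 (x a)) (𝓝 ‖x a - x a‖) :=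
        (continuous_id.sub continuous_const).norm.tendsto _
      simpa using this)
  rw [isLittleO_norm_right] at h
  rw [hasFDerivAt_iff_isLittleO]
  refine h.congr' ?_ EventuallyEq.rfl
  filter_upwards [hy] with z hz
  simp [hSb, hz.1, hyx]

/-- The first order response of the solution of `x' = f x` to the source `ε g`. -/
theorem hasDerivAt_perturbed_endpoint [CompleteSpace E]
    {f : E → E} {f' : E → E →L[ℝ] E} {B : Set E} (hB : IsCompact B) (hBc : Convex ℝ B)
    (hf : ∀ z ∈ B, HasFDerivWithinAt f (f' z) B z) (hf' : ContinuousOn f' B)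
    {g : ℝ → E → E} {a b : ℝ} (hab : a ≤ b)
    (hg : ContinuousOn (fun p : ℝ × E => g p.1 p.2) (Icc a b ×ˢ B))
    {S : ℝ → E →L[ℝ] E} {y : ℝ → ℝ → E} {δ : E}
    (hx : ∀ s ∈ Icc a b, HasDerivWithinAt (y 0) (f (y 0 s)) (Icc a b) s)
    (hxB : ∀ s ∈ Icc a b, y 0 s ∈ B)
    (hS : ∀ s ∈ Icc a b, HasDerivWithinAt S (-(S s ∘L f' (y 0 s))) (Icc a b) s)
    (hSb : S b = ContinuousLinearMap.id ℝ E)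
    (hy : ∀ᶠ ε in 𝓝[≠] 0, ∀ s ∈ Icc a b,
      HasDerivWithinAt (y ε) (f (y ε s) + ε • g s (y ε s)) (Icc a b) s ∧ y ε s ∈ B)
    (hδ : HasDerivAt (fun ε => y ε a) δ 0) :
    HasDerivAt (fun ε => y ε b) (S a δ + ∫ s in a..b, S s (g s (y 0 s))) 0 := by
  obtain ⟨K, hK, -⟩ := exists_lipschitzOnWith_of_continuousOn_deriv hB hBc hf hf'
  have hxc : ContinuousOn (y 0) (Icc a b) := fun s hs => (hx s hs).continuousWithinAt
  have hSc : ContinuousOn S (Icc a b) := fun s hs => (hS s hs).continuousWithinAt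
  obtain ⟨C, hC⟩ := isCompact_Icc.exists_bound_of_continuousOn hSc
  have hC0 : 0 ≤ C := (norm_nonneg _).trans (hC a (left_mem_Icc.2 hab))
  have hcpt : IsCompact (Icc a b ×ˢ B) := isCompact_Icc.prod hB
  obtain ⟨G, hG⟩ := hcpt.exists_bound_of_continuousOn hg
  have hG0 : 0 ≤ G := (norm_nonneg _).trans
    (hG (a, y 0 a) ⟨left_mem_Icc.2 hab, hxB a (left_mem_Icc.2 hab)⟩)
  have hgc : ∀ {z : ℝ → E}, ContinuousOn z (Icc a b) → (∀ s ∈ Icc a b, z s ∈ B) →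
      ContinuousOn (fun s => g s (z s)) (Icc a b) := fun hz hzB =>
    hg.comp (continuousOn_id.prodMk hz) fun s hs => ⟨hs, hzB s hs⟩
  have hδ' := (hasDerivAt_iff_isLittleO.1 hδ).mono (nhdsWithin_le_nhds (s := {0}ᶜ))
  simp only [sub_zero] at hδ'
  -- `M * ‖ε‖` bounds both the initial deviation, for small `ε`, and the source `ε g`.
  set M := ‖δ‖ + 1 + G with hM
  have hM0 : 0 < M := by positivity
  have hya : ∀ᶠ ε in 𝓝[≠] (0 : ℝ), ‖y ε a - y 0 a‖ ≤ M * ‖ε‖ := by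
    filter_upwards [isLittleO_iff.1 hδ' one_pos] with ε hε
    have h1 : ‖y ε a - y 0 a‖ ≤ ‖y ε a - y 0 a - ε • δ‖ + ‖ε • δ‖ := by
      simpa using norm_add_le (y ε a - y 0 a - ε • δ) (ε • δ)
    rw [norm_smul] at h1
    nlinarith [norm_nonneg ε, mul_nonneg hG0 (norm_nonneg ε)]
  have hMt : Tendsto (fun ε : ℝ => M * ‖ε‖) (𝓝[≠] 0) (𝓝 0) := by
    have : Tendsto (fun ε : ℝ => M * ‖ε‖) (𝓝 0) (𝓝 (M * ‖(0 : ℝ)‖)) :=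
      (continuous_const.mul continuous_norm).tendsto _
    rw [norm_zero, mul_zero] at this
    exact this.mono_left nhdsWithin_le_nhds
  have hsol : ∀ᶠ ε in 𝓝[≠] (0 : ℝ), ∀ s ∈ Icc a b,
      HasDerivWithinAt (y ε) (f (y ε s) + ε • g s (y ε s)) (Icc a b) s ∧ y ε s ∈ B ∧
        ‖ε • g s (y ε s)‖ ≤ M * ‖ε‖ := by
    filter_upwards [hy] with ε hε s hs
    refine ⟨(hε s hs).1, (hε s hs).2, ?_⟩
    rw [norm_smul, mul_comm]
    refine mul_le_mul_of_nonneg_right ?_ (norm_nonneg ε)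
    exact (hG (s, y ε s) ⟨hs, (hε s hs).2⟩).trans (by rw [hM]; linarith [norm_nonneg δ])
  have hyc : ∀ᶠ ε in 𝓝[≠] (0 : ℝ), ContinuousOn (fun s => g s (y ε s)) (Icc a b) := by
    filter_upwards [hy] with ε hε
    exact hgc (fun s hs => (hε s hs).1.continuousWithinAt) fun s hs => (hε s hs).2
  have h1 := isLittleO_variation_of_constants hB hBc hf hf' hab hx hxB hS hsol
    (hyc.mono fun ε hε => hε.const_smul ε)
    (fun ε => mul_nonneg hM0.le (norm_nonneg ε)) hya hMt
  have h1' := (isLittleO_const_mul_right_iff hM0.ne').1 h1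
  rw [isLittleO_norm_right] at h1'
  have h2 : (fun ε => S a (y ε a - y 0 a - ε • δ)) =o[𝓝[≠] 0] fun ε : ℝ => ε :=
    ((S a).isBigO_comp _ _).trans_isLittleO hδ'
  -- Evaluating the source along the perturbed instead of the unperturbed curve costs only `o(ε)`:
  -- the curves are uniformly close and `g` is uniformly continuous on the compact set.
  have h3 : (fun ε : ℝ => ε • ∫ s in a..b, (S s (g s (y ε s)) - S s (g s (y 0 s))))
      =o[𝓝[≠] 0] fun ε : ℝ => ε := by
    rw [isLittleO_iff]
    intro c hc
    have hden : 0 < C * (b - a) + 1 := by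
      have := sub_nonneg.2 hab
      positivity
    obtain ⟨d, hd, hud⟩ := Metric.uniformContinuousOn_iff.1
      (hcpt.uniformContinuousOn_of_continuous hg) (c / (C * (b - a) + 1)) (div_pos hc hden)
    have hsmall : ∀ᶠ ε in 𝓝[≠] (0 : ℝ), M * ‖ε‖ * gronwallBound 1 K 1 (b - a) < d := by
      have h := hMt.mul_const (gronwallBound 1 K 1 (b - a))
      rw [zero_mul] at h
      exact h.eventually_lt_const hd
    filter_upwards [hsol, hya, hsmall] with ε hε hεa hεd
    rw [norm_smul, mul_comm]
    refine mul_le_mul_of_nonneg_right ?_ (norm_nonneg ε)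
    have hgr := norm_sub_le_mul_gronwallBound hK hx hxB (fun s hs => (hε s hs).1)
      (fun s hs => (hε s hs).2.1) (mul_nonneg hM0.le (norm_nonneg ε)) hεa
      (fun s hs => (hε s hs).2.2)
    have hb : ∀ s ∈ uIoc a b, ‖S s (g s (y ε s)) - S s (g s (y 0 s))‖ ≤
        C * (c / (C * (b - a) + 1)) := by
      intro s hs
      rw [uIoc_of_le hab] at hs
      have hs' := Ioc_subset_Icc_self hs
      rw [← map_sub]
      refine ((S s).le_opNorm _).trans (mul_le_mul (hC s hs') ?_ (norm_nonneg _) hC0)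
      rw [← dist_eq_norm]
      refine (hud (s, y ε s) ⟨hs', (hε s hs').2.1⟩ (s, y 0 s) ⟨hs', hxB s hs'⟩ ?_).le
      rw [Prod.dist_eq, dist_self, max_eq_right dist_nonneg, dist_eq_norm]
      exact (hgr s hs').trans_lt hεd
    refine (intervalIntegral.norm_integral_le_of_norm_le_const hb).trans ?_
    rw [abs_of_nonneg (sub_nonneg.2 hab)]
    have h5 : C * (c / (C * (b - a) + 1)) * (b - a) =
        c / (C * (b - a) + 1) * (C * (b - a)) := by ring
    rw [h5]
    calc c / (C * (b - a) + 1) * (C * (b - a)) ≤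
        c / (C * (b - a) + 1) * (C * (b - a) + 1) := by
          have := div_pos hc hden
          gcongr; linarith
      _ = c := by field_simp
  -- A derivative at `0` depends on the difference quotients for `ε ≠ 0` only, so the punctured
  -- neighbourhood suffices.
  rw [← hasDerivWithinAt_univ, ← hasDerivWithinAt_sdiff_singleton, ← compl_eq_univ_sdiff,
    hasDerivWithinAt_iff_isLittleO]
  simp only [sub_zero]
  refine ((h1'.add h2).add h3).congr' ?_ EventuallyEq.rfl
  filter_upwards [hyc] with ε hε
  have hi : IntervalIntegrable (fun s => S s (g s (y ε s))) volume a b :=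
    ContinuousOn.intervalIntegrable (by rw [uIcc_of_le hab]; exact hSc.clm_apply hε)
  have hi0 : IntervalIntegrable (fun s => S s (g s (y 0 s))) volume a b :=
    ContinuousOn.intervalIntegrable
      (by rw [uIcc_of_le hab]; exact hSc.clm_apply (hgc hxc hxB))
  simp only [map_smul, intervalIntegral.integral_smul, intervalIntegral.integral_sub hi hi0, hSb,
    map_sub, smul_sub, smul_add, ContinuousLinearMap.id_apply]
  abel

end OrdinaryDifferentialEquations

/-! ### Curves on a manifold read in charts, and concatenation of integral curves. -/

section CurvesOnManifolds

open Metric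

variable {E : Type*} [NormedAddCommGroup E] [NormedSpace ℝ E]
  {M : Type*} [TopologicalSpace M] [ChartedSpace E M]

/-- The differential of a chart `e` at `q`, in terms of the preferred chart at `q`. -/
noncomputable def chartDeriv (e : OpenPartialHomeomorph M E) (q : M) : E →L[ℝ] E :=
  mfderiv 𝓘(ℝ, E) 𝓘(ℝ, E) e q

/-- The differential at `z` of the inverse of a chart `e`. -/
noncomputable def chartSymmDeriv (e : OpenPartialHomeomorph M E) (z : E) : E →L[ℝ] E :=
  mfderiv 𝓘(ℝ, E) 𝓘(ℝ, E) e.symm z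

/-- `c` has at time `s`, within the time interval `S`, the velocity `v`. -/
def HasVelocityWithinAt (c : ℝ → M) (v : E) (S : Set ℝ) (s : ℝ) : Prop :=
  HasMFDerivWithinAt 𝓘(ℝ, ℝ) 𝓘(ℝ, E) c S s
    ((1 : ℝ →L[ℝ] ℝ).smulRight v : ℝ →L[ℝ] E)

variable {e : OpenPartialHomeomorph M E}

theorem chartSymmDeriv_chartDeriv (he : e.MDifferentiable 𝓘(ℝ, E) 𝓘(ℝ, E))
    {q : M} (hq : q ∈ e.source) (v : E) :
    chartSymmDeriv e (e q) (chartDeriv e q v) = v :=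
  DFunLike.congr_fun (he.symm_comp_deriv hq) v

theorem chartDeriv_chartSymmDeriv (he : e.MDifferentiable 𝓘(ℝ, E) 𝓘(ℝ, E))
    {q : M} (hq : q ∈ e.source) (v : E) :
    chartDeriv e q (chartSymmDeriv e (e q) v) = v := by
  have h := DFunLike.congr_fun (he.comp_symm_deriv (e.map_source hq)) v
  have h2 : chartDeriv e (e.symm (e q)) (chartSymmDeriv e (e q) v) = v := h
  rwa [e.left_inv hq] at h2

theorem hasMFDerivAt_chart (he : e.MDifferentiable 𝓘(ℝ, E) 𝓘(ℝ, E))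
    {q : M} (hq : q ∈ e.source) :
    HasMFDerivAt 𝓘(ℝ, E) 𝓘(ℝ, E) e q (chartDeriv (E := E) e q) :=
  (he.mdifferentiableAt hq).hasMFDerivAt

theorem hasMFDerivAt_chart_symm (he : e.MDifferentiable 𝓘(ℝ, E) 𝓘(ℝ, E))
    {z : E} (hz : z ∈ e.target) :
    HasMFDerivAt 𝓘(ℝ, E) 𝓘(ℝ, E) e.symm z (chartSymmDeriv (M := M) (E := E) e z) :=
  (he.mdifferentiableAt_symm hz).hasMFDerivAt

theorem HasVelocityWithinAt.chart (he : e.MDifferentiable 𝓘(ℝ, E) 𝓘(ℝ, E))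
    {c : ℝ → M} {v : E} {S : Set ℝ} {s : ℝ}
    (h : HasVelocityWithinAt c v S s) (hs : c s ∈ e.source) :
    HasDerivWithinAt (fun u => e (c u)) (chartDeriv e (c s) v) S s := by
  have h1 := (hasMFDerivAt_chart he hs).comp_hasMFDerivWithinAt s h
  have h2 : HasFDerivWithinAt (fun u => e (c u))
      ((chartDeriv e (c s)).comp ((1 : ℝ →L[ℝ] ℝ).smulRight v)) S s := h1.hasFDerivWithinAt
  refine h2.hasDerivWithinAt.congr_deriv ?_
  simp

theorem HasDerivWithinAt.chart_symm (he : e.MDifferentiable 𝓘(ℝ, E) 𝓘(ℝ, E))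
    {x : ℝ → E} {w : E} {S : Set ℝ} {s : ℝ}
    (h : HasDerivWithinAt x w S s) (hs : x s ∈ e.target) :
    HasVelocityWithinAt (fun u => e.symm (x u)) (chartSymmDeriv e (x s) w) S s := by
  have h1 := (hasMFDerivAt_chart_symm he hs).comp_hasMFDerivWithinAt s
    h.hasFDerivWithinAt.hasMFDerivWithinAt
  refine h1.congr_mfderiv ?_
  refine ContinuousLinearMap.ext_ring ?_
  change chartSymmDeriv e (x s) ((ContinuousLinearMap.toSpanSingleton ℝ w) (1 : ℝ)) =
    ((1 : ℝ →L[ℝ] ℝ).smulRight (chartSymmDeriv e (x s) w)) (1 : ℝ)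
  simp

theorem HasMFDerivAt.hasDerivAt_chart (he : e.MDifferentiable 𝓘(ℝ, E) 𝓘(ℝ, E))
    {c : ℝ → M} {v : E} {s : ℝ}
    (h : HasMFDerivAt 𝓘(ℝ, ℝ) 𝓘(ℝ, E) c s
      ((1 : ℝ →L[ℝ] ℝ).smulRight v : ℝ →L[ℝ] E)) (hs : c s ∈ e.source) :
    HasDerivAt (fun u => e (c u)) (chartDeriv e (c s) v) s := by
  rw [← hasDerivWithinAt_univ]
  exact HasVelocityWithinAt.chart he h.hasMFDerivWithinAt hs

theorem HasDerivAt.hasMFDerivAt_chart_symm (he : e.MDifferentiable 𝓘(ℝ, E) 𝓘(ℝ, E))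
    {x : ℝ → E} {w : E} {s : ℝ}
    (h : HasDerivAt x w s) (hs : x s ∈ e.target) :
    HasMFDerivAt 𝓘(ℝ, ℝ) 𝓘(ℝ, E) (fun u => e.symm (x u)) s
      ((1 : ℝ →L[ℝ] ℝ).smulRight (chartSymmDeriv e (x s) w) : ℝ →L[ℝ] E) :=
  hasMFDerivWithinAt_univ.1 (HasDerivWithinAt.chart_symm he h.hasDerivWithinAt hs)

/-- A curve that starts in the half ball and whose speed is bounded in the ball cannot leave the
ball within a short time; it then solves in the chart the differential equation of its velocity. -/
theorem chart_curve_mem_closedBall [T2Space M] [ProperSpace E]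
    (he : e.MDifferentiable 𝓘(ℝ, E) 𝓘(ℝ, E)) {x₀ : E} {r C a b : ℝ}
    (hball : closedBall x₀ r ⊆ e.target) (hCr : C * (b - a) < r / 2) (hC : 0 ≤ C)
    {c : ℝ → M} {v : ℝ → E} {h : ℝ → E → E}
    (hc : ∀ s ∈ Icc a b, HasVelocityWithinAt c (v s) (Icc a b) s)
    (hv : ∀ s ∈ Icc a b, c s ∈ e.source → e (c s) ∈ closedBall x₀ r →
      chartDeriv e (c s) (v s) = h s (e (c s)) ∧ ‖h s (e (c s))‖ ≤ C)
    (ha : c a ∈ e.source) (ha' : e (c a) ∈ closedBall x₀ (r / 2)) :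
    ∀ s ∈ Icc a b, c s ∈ e.source ∧ e (c s) ∈ closedBall x₀ r ∧
      HasDerivWithinAt (fun u => e (c u)) (h s (e (c s))) (Icc a b) s := by
  rcases lt_or_ge b a with hba | hab
  · intro s hs
    exact absurd (hs.1.trans hs.2) (not_le.2 hba)
  have hr : 0 < r := by nlinarith [mul_nonneg hC (sub_nonneg.2 hab)]
  have hderiv : ∀ s ∈ Icc a b, c s ∈ e.source → e (c s) ∈ closedBall x₀ r →
      HasDerivWithinAt (fun u => e (c u)) (h s (e (c s))) (Icc a b) s := by
    intro s hs h1 h2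
    rw [← (hv s hs h1 h2).1]
    exact HasVelocityWithinAt.chart he (hc s hs) h1
  have hcc : ContinuousOn c (Icc a b) := fun s hs => (hc s hs).continuousWithinAt
  set Q : Set M := e.source ∩ e ⁻¹' closedBall x₀ r with hQ
  -- `Q` is the image of a compact ball under the inverse chart. That it is closed in `M` uses the
  -- Hausdorff property; otherwise the curve could leave the chart domain without reaching the
  -- boundary of the ball.
  have hQc : IsClosed Q := by
    have : Q = e.symm '' closedBall x₀ r := by
      rw [e.symm_image_eq_source_inter_preimage hball]
    rw [this]
    exact ((isCompact_closedBall x₀ r).image_of_continuousOn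
      (e.continuousOn_symm.mono hball)).isClosed
  -- Continuous induction: `Z` is closed and can be extended to the right from each of its points.
  -- Recording the distance bound `C * (s - a)`, which is less than `r / 2`, keeps the curve in the
  -- open ball, so that the speed bound holds a little longer.
  let Z : Set ℝ := {s | c s ∈ Q ∧ ‖e (c s) - e (c a)‖ - C * (s - a) ≤ 0}
  have hZclosed : IsClosed (Z ∩ Icc a b) := by
    have h1 : IsClosed (Icc a b ∩ c ⁻¹' Q) := hcc.preimage_isClosed_of_isClosed isClosed_Icc hQc
    have h2 : ContinuousOn (fun s => ‖e (c s) - e (c a)‖ - C * (s - a)) (Icc a b ∩ c ⁻¹' Q) := by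
      have h3 : ContinuousOn (fun s => e (c s)) (Icc a b ∩ c ⁻¹' Q) :=
        e.continuousOn.comp (hcc.mono inter_subset_left) fun s hs => hs.2.1
      exact (h3.sub continuousOn_const).norm.sub (by fun_prop)
    have h4 := h2.preimage_isClosed_of_isClosed h1 isClosed_Iic (t := Iic 0)
    convert h4 using 1
    ext s
    simp only [Z, mem_inter_iff, mem_ofPred_eq, mem_preimage, mem_Iic]
    tauto
  have hmain : Icc a b ⊆ Z := by
    refine hZclosed.Icc_subset_of_forall_exists_gt ?_ ?_
    · exact ⟨⟨ha, closedBall_subset_closedBall (by linarith) ha'⟩, by simp⟩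
    · rintro x ⟨⟨hxQ, hxn⟩, hxa⟩ y hy
      have hxI := Ico_subset_Icc_self hxa
      have hmemball : e (c x) ∈ ball x₀ r := by
        rw [mem_ball]
        have h1 : C * (x - a) ≤ C * (b - a) :=
          mul_le_mul_of_nonneg_left (by linarith [hxa.2]) hC
        have h2 := dist_triangle (e (c x)) (e (c a)) x₀
        rw [mem_closedBall] at ha'
        rw [dist_eq_norm (e (c x)) (e (c a))] at h2
        linarith
      have hopen : IsOpen (e.source ∩ e ⁻¹' ball x₀ r) := e.isOpen_inter_preimage isOpen_ball
      have hev : ∀ᶠ u in 𝓝[≥] x, c u ∈ e.source ∩ e ⁻¹' ball x₀ r := by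
        have h1 : ContinuousWithinAt c (Ici x) x :=
          (hcc x hxI).mono_of_mem_nhdsWithin (Icc_mem_nhdsGE_of_mem hxa)
        exact h1.eventually_mem (hopen.mem_nhds ⟨hxQ.1, hmemball⟩)
      obtain ⟨u, hu, hsub⟩ := mem_nhdsGE_iff_exists_Icc_subset.1 hev
      set z := min u (min y b) with hz
      have hxz : x < z := lt_min hu (lt_min hy hxa.2)
      have hzb : z ≤ b := (min_le_right _ _).trans (min_le_right _ _)
      have hin : ∀ w ∈ Icc x z, c w ∈ e.source ∧ e (c w) ∈ ball x₀ r := fun w hw =>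
        hsub ⟨hw.1, hw.2.trans (min_le_left _ _)⟩
      have hIcc : ∀ w ∈ Icc x z, w ∈ Icc a b := fun w hw =>
        ⟨hxa.1.trans hw.1, hw.2.trans hzb⟩
      have hmv := norm_image_sub_le_of_norm_deriv_le_segment' (f := fun u => e (c u))
        (f' := fun w => h w (e (c w))) (C := C) (a := x) (b := z)
        (fun w hw => ((hderiv w (hIcc w hw) (hin w hw).1
          (ball_subset_closedBall (hin w hw).2)).mono fun w' hw' => hIcc w' hw'))
        (fun w hw => (hv w (hIcc w (Ico_subset_Icc_self hw)) (hin w (Ico_subset_Icc_self hw)).1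
          (ball_subset_closedBall (hin w (Ico_subset_Icc_self hw)).2)).2) z
        (right_mem_Icc.2 hxz.le)
      refine ⟨z, ⟨⟨?_, ?_⟩, hxz, (min_le_right _ _).trans (min_le_left _ _)⟩⟩
      · exact ⟨(hin z (right_mem_Icc.2 hxz.le)).1,
          ball_subset_closedBall (hin z (right_mem_Icc.2 hxz.le)).2⟩
      · have h1 : ‖e (c z) - e (c a)‖ ≤ ‖e (c z) - e (c x)‖ + ‖e (c x) - e (c a)‖ := by
          simpa using norm_add_le (e (c z) - e (c x)) (e (c x) - e (c a))
        have h2 : C * (z - a) = C * (z - x) + C * (x - a) := by ring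
        linarith
  intro s hs
  obtain ⟨hsQ, -⟩ := hmain hs
  exact ⟨hsQ.1, hsQ.2, hderiv s hs hsQ.1 hsQ.2⟩

/-- `z` is the end point of an integral curve of `X` that starts in `y` and lasts for the time
`τ`. -/
def Reaches (X : ∀ q : M, TangentSpace 𝓘(ℝ, E) q) (τ : ℝ) (y z : M) : Prop :=
  ∃ c : ℝ → M, c 0 = y ∧ IsMIntegralCurveOn c X (Icc 0 τ) ∧ c τ = z

theorem IsMIntegralCurveOn.reaches {X : ∀ q : M, TangentSpace 𝓘(ℝ, E) q} {c : ℝ → M} {a b : ℝ}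
    (h : IsMIntegralCurveOn c X (Icc a b)) : Reaches X (b - a) (c a) (c b) := by
  refine ⟨c ∘ (· + a), by simp, (h.comp_add a).mono fun s hs => ?_, by simp⟩
  exact ⟨by linarith [hs.1], by linarith [hs.2]⟩

/-- At the junction both one-sided velocities equal the field at `c b`; at other times one of the
two intervals is a neighbourhood within the union. -/
theorem IsMIntegralCurveOn.Icc_union {X : ∀ q : M, TangentSpace 𝓘(ℝ, E) q} {c : ℝ → M} {a b d : ℝ}
    (hab : a ≤ b) (hbd : b ≤ d)
    (h : IsMIntegralCurveOn c X (Icc a b)) (h' : IsMIntegralCurveOn c X (Icc b d)) :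
    IsMIntegralCurveOn c X (Icc a d) := by
  intro s hs
  rcases lt_trichotomy s b with hsb | rfl | hsb
  · refine (h s ⟨hs.1, hsb.le⟩).mono_of_mem_nhdsWithin ?_
    filter_upwards [self_mem_nhdsWithin, mem_nhdsWithin_of_mem_nhds (Iio_mem_nhds hsb)] with u hu hub
    exact ⟨hu.1, le_of_lt hub⟩
  · rw [← Icc_union_Icc_eq_Icc hab hbd]
    exact (h s ⟨hs.1, le_rfl⟩).union (h' s ⟨le_rfl, hs.2⟩)
  · refine (h' s ⟨hsb.le, hs.2⟩).mono_of_mem_nhdsWithin ?_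
    filter_upwards [self_mem_nhdsWithin, mem_nhdsWithin_of_mem_nhds (Ioi_mem_nhds hsb)] with u hu hub
    exact ⟨le_of_lt hub, hu.2⟩

theorem IsMIntegralCurveOn.congr {X : ∀ q : M, TangentSpace 𝓘(ℝ, E) q} {c c' : ℝ → M} {S : Set ℝ}
    (h : IsMIntegralCurveOn c X S) (hc : EqOn c' c S) : IsMIntegralCurveOn c' X S := by
  intro s hs
  have h1 := (h s hs).congr_mono hc (hc hs) le_rfl
  -- The velocities at `c s` and `c' s` have different tangent spaces as types, both copies of `E`;
  -- substitution of the point compares them in `E`.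
  have h2 : ∀ q, q = c s → ((1 : ℝ →L[ℝ] ℝ).smulRight (X (c s) : E) : ℝ →L[ℝ] E) =
      (1 : ℝ →L[ℝ] ℝ).smulRight (X q : E) := by
    rintro q rfl
    rfl
  exact h1.congr_mfderiv (h2 _ (hc hs))

/-- The semigroup law for the relation, by restricting and concatenating curves. No uniqueness is
involved, so it applies before the flow is known to be well defined. -/
theorem reaches_add {X : ∀ q : M, TangentSpace 𝓘(ℝ, E) q} {τ τ' : ℝ} (hτ : 0 ≤ τ) (hτ' : 0 ≤ τ')
    {y z : M} : Reaches X (τ + τ') y z ↔ ∃ w, Reaches X τ y w ∧ Reaches X τ' w z := by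
  constructor
  · rintro ⟨c, h0, hc, h1⟩
    refine ⟨c τ, ⟨c, h0, hc.mono (Icc_subset_Icc_right (by linarith)), rfl⟩, ?_⟩
    have h := (hc.mono (Icc_subset_Icc_left hτ)).reaches
    rwa [add_sub_cancel_left, h1] at h
  · rintro ⟨w, ⟨c, h0, hc, h1⟩, c', h0', hc', h1'⟩
    let k : ℝ → M := fun s => if s ≤ τ then c s else c' (s - τ)
    have hk1 : EqOn k c (Icc 0 τ) := fun s hs => if_pos hs.2
    have hk2 : EqOn k (c' ∘ (· + -τ)) (Icc τ (τ + τ')) := by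
      intro s hs
      rcases hs.1.eq_or_lt with rfl | h
      · change (if τ ≤ τ then c τ else _) = c' (τ + -τ)
        rw [if_pos le_rfl, h1, add_neg_cancel, h0']
      · change (if s ≤ τ then c s else c' (s - τ)) = c' (s + -τ)
        rw [if_neg (not_le.2 h), sub_eq_add_neg]
    refine ⟨k, (hk1 ⟨le_rfl, hτ⟩).trans h0, ?_, ?_⟩
    · refine (hc.congr hk1).Icc_union hτ (by linarith) (IsMIntegralCurveOn.congr ?_ hk2)
      refine (hc'.comp_add (-τ)).mono fun s hs => ?_
      exact ⟨by linarith [hs.1], by linarith [hs.2]⟩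
    · rw [hk2 ⟨by linarith, le_rfl⟩, ← h1']
      change c' (τ + τ' + -τ) = _
      rw [add_neg_cancel_comm]

end CurvesOnManifolds

/-! ### Flow boxes: the local flow, its differential and the local response. -/

section FlowBoxes

open Metric
open scoped NNReal

variable {E : Type*} [NormedAddCommGroup E] [NormedSpace ℝ E]
  {M : Type*} [TopologicalSpace M] [ChartedSpace E M]

/-- The vector field `X` is given, on the preimage of the closed ball of radius `r` about `x₀` in
the chart `e`, by a `C¹` field `f` with derivative `f'`; with bounds. -/
structure IsFlowBox (X : ∀ q : M, TangentSpace 𝓘(ℝ, E) q) (e : OpenPartialHomeomorph M E)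
    (x₀ : E) (r C : ℝ) (K : ℝ≥0) (f : E → E) (f' : E → E →L[ℝ] E) : Prop where
  mdifferentiable : e.MDifferentiable 𝓘(ℝ, E) 𝓘(ℝ, E)
  ball_subset : closedBall x₀ r ⊆ e.target
  field_eq : ∀ q ∈ e.source, e q ∈ closedBall x₀ r → chartDeriv e q (X q) = f (e q)
  hasFDerivWithinAt : ∀ z ∈ closedBall x₀ r, HasFDerivWithinAt f (f' z) (closedBall x₀ r) z
  continuousOn : ContinuousOn f' (closedBall x₀ r)
  lipschitzOnWith : LipschitzOnWith K f (closedBall x₀ r)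
  norm_le : ∀ z ∈ closedBall x₀ r, ‖f z‖ ≤ C
  norm_deriv_le : ∀ z ∈ closedBall x₀ r, ‖f' z‖ ≤ K
  pos : 0 < r
  nonneg : 0 ≤ C

namespace IsFlowBox

variable {X : ∀ q : M, TangentSpace 𝓘(ℝ, E) q} {e : OpenPartialHomeomorph M E}
  {x₀ : E} {r C : ℝ} {K : ℝ≥0} {f : E → E} {f' : E → E →L[ℝ] E}

theorem isMIntegralCurveOn_symm (h : IsFlowBox X e x₀ r C K f f') {y : ℝ → E} {S : Set ℝ}
    (hy : ∀ s ∈ S, HasDerivWithinAt y (f (y s)) S s ∧ y s ∈ closedBall x₀ r) :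
    IsMIntegralCurveOn (fun s => e.symm (y s)) X S := by
  intro s hs
  have ht := h.ball_subset (hy s hs).2
  have h1 := HasDerivWithinAt.chart_symm h.mdifferentiable (hy s hs).1 ht
  have h2 := h.field_eq (e.symm (y s)) (e.map_target ht) (by rw [e.right_inv ht]; exact (hy s hs).2)
  have h3 := chartSymmDeriv_chartDeriv h.mdifferentiable (e.map_target ht) (X (e.symm (y s)))
  rw [h2, e.right_inv ht] at h3
  rw [h3] at h1
  exact h1

variable [FiniteDimensional ℝ E]

theorem exists_curve (h : IsFlowBox X e x₀ r C K f f') {a b : ℝ} (hab : a ≤ b)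
    (hC : C * (b - a) < r / 2) {z : E} (hz : z ∈ closedBall x₀ (r / 2)) :
    ∃ y : ℝ → E, y a = z ∧ ∀ s ∈ Icc a b,
      HasDerivWithinAt y (f (y s)) (Icc a b) s ∧ y s ∈ closedBall x₀ r :=
  have : CompleteSpace E := FiniteDimensional.complete ℝ E
  exists_hasDerivWithinAt_mem_closedBall hab h.pos.le h.nonneg h.lipschitzOnWith h.norm_le hz hC.le

variable [T2Space M]

theorem chart_integralCurve (h : IsFlowBox X e x₀ r C K f f') {a b : ℝ}
    (hC : C * (b - a) < r / 2) {c : ℝ → M} (hc : IsMIntegralCurveOn c X (Icc a b))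
    (ha : c a ∈ e.source) (ha' : e (c a) ∈ closedBall x₀ (r / 2)) :
    ∀ s ∈ Icc a b, c s ∈ e.source ∧ e (c s) ∈ closedBall x₀ r ∧
      HasDerivWithinAt (fun u => e (c u)) (f (e (c s))) (Icc a b) s :=
  have : ProperSpace E := FiniteDimensional.proper ℝ E
  chart_curve_mem_closedBall h.mdifferentiable h.ball_subset hC h.nonneg (h := fun _ => f) hc
    (fun _ _ h1 h2 => ⟨h.field_eq _ h1 h2, h.norm_le _ h2⟩) ha ha'

/-- Inside a flow box the relation is a function: any integral curve on `M` from the half ball stays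
in the chart and solves the equation of `f` there, and Grönwall's inequality with `ρ = 0` identifies
it with `y`. -/
theorem reaches_iff (h : IsFlowBox X e x₀ r C K f f') {a b : ℝ} (hab : a ≤ b)
    (hC : C * (b - a) < r / 2) {q z : M} (hq : q ∈ e.source) (hq' : e q ∈ closedBall x₀ (r / 2))
    {y : ℝ → E} (hya : y a = e q)
    (hy : ∀ s ∈ Icc a b, HasDerivWithinAt y (f (y s)) (Icc a b) s ∧ y s ∈ closedBall x₀ r) :
    Reaches X (b - a) q z ↔ z = e.symm (y b) := by
  constructor
  · rintro ⟨c, h0, hc, hcz⟩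
    have hc' : IsMIntegralCurveOn (c ∘ (· + -a)) X (Icc a b) :=
      (hc.comp_add (-a)).mono fun s hs => ⟨by linarith [hs.1], by linarith [hs.2]⟩
    have hca : (c ∘ (· + -a)) a = q := by simp [h0]
    have hch := h.chart_integralCurve hC hc' (by rwa [hca]) (by rwa [hca])
    have hg := norm_sub_le_mul_gronwallBound (ρ := 0) (r := 0) h.lipschitzOnWith
      (fun s hs => (hy s hs).1) (fun s hs => (hy s hs).2)
      (y := fun u => e ((c ∘ (· + -a)) u)) (fun s hs => by simpa using (hch s hs).2.2)
      (fun s hs => (hch s hs).2.1) le_rfl (by simp only [hca, hya]; simp) (fun s hs => by simp)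
      b (right_mem_Icc.2 hab)
    rw [zero_mul, norm_le_zero_iff, sub_eq_zero] at hg
    rw [← hg, e.left_inv (hch b (right_mem_Icc.2 hab)).1, ← hcz, Function.comp_apply,
      sub_eq_add_neg]
  · rintro rfl
    have h1 := (h.isMIntegralCurveOn_symm hy).reaches
    rwa [hya, e.left_inv hq] at h1

theorem existsUnique_reaches (h : IsFlowBox X e x₀ r C K f f') {a b : ℝ} (hab : a ≤ b)
    (hC : C * (b - a) < r / 2) {q : M} (hq : q ∈ e.source) (hq' : e q ∈ closedBall x₀ (r / 2)) :
    ∃! z, Reaches X (b - a) q z := by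
  obtain ⟨y, hya, hy⟩ := h.exists_curve hab hC hq'
  have h1 := fun z => h.reaches_iff (z := z) hab hC hq hq' hya hy
  exact ⟨_, (h1 _).2 rfl, fun z hz => (h1 z).1 hz⟩

/-- The differential of the flow is the adjoint resolvent. -/
theorem hasMFDerivAt_flow (h : IsFlowBox X e x₀ r C K f f') {a b : ℝ} (hab : a ≤ b)
    (hC : C * (b - a) < r / 2) {c : ℝ → M} (hc : IsMIntegralCurveOn c X (Icc a b))
    (ha : c a ∈ e.source) (ha' : e (c a) ∈ ball x₀ (r / 2)) {S : ℝ → E →L[ℝ] E}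
    (hS : ∀ s ∈ Icc a b, HasDerivWithinAt S (-(S s ∘L f' (e (c s)))) (Icc a b) s)
    (hSb : S b = ContinuousLinearMap.id ℝ E) {Φ : M → M}
    (hΦ : ∀ q, (∃ z, Reaches X (b - a) q z) → Reaches X (b - a) q (Φ q)) :
    HasMFDerivAt 𝓘(ℝ, E) 𝓘(ℝ, E) Φ (c a)
      (chartSymmDeriv e (e (c b)) ∘L S a ∘L chartDeriv e (c a) : E →L[ℝ] E) := by
  have : CompleteSpace E := FiniteDimensional.complete ℝ E
  have : ProperSpace E := FiniteDimensional.proper ℝ E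
  have ha'' := ball_subset_closedBall ha'
  have hch := h.chart_integralCurve hC hc ha ha''
  -- The solutions are chosen for all starting points at once; the default curve `0` outside the
  -- half ball is never used.
  have hex : ∀ z, ∃ y : ℝ → E, z ∈ closedBall x₀ (r / 2) → y a = z ∧ ∀ s ∈ Icc a b,
      HasDerivWithinAt y (f (y s)) (Icc a b) s ∧ y s ∈ closedBall x₀ r := by
    intro z
    by_cases hz : z ∈ closedBall x₀ (r / 2)
    · obtain ⟨y, hy⟩ := h.exists_curve hab hC hz
      exact ⟨y, fun _ => hy⟩
    · exact ⟨0, fun h => absurd h hz⟩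
  choose y hy using hex
  have hyc : y (e (c a)) b = e (c b) := by
    have h1 := (h.reaches_iff hab hC ha ha'' (hy _ ha'').1 (hy _ ha'').2).1 hc.reaches
    rw [h1, e.right_inv]
    exact h.ball_subset ((hy _ ha'').2 b (right_mem_Icc.2 hab)).2
  have hev : ∀ᶠ z in 𝓝 (e (c a)), z ∈ closedBall x₀ (r / 2) :=
    mem_of_superset (isOpen_ball.mem_nhds ha') ball_subset_closedBall
  have hd : HasFDerivAt (fun z => y z b) (S a) (e (c a)) :=
    hasFDerivAt_endpoint (x := fun s => e (c s)) (isCompact_closedBall x₀ r)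
      (convex_closedBall x₀ r) h.hasFDerivWithinAt h.continuousOn hab
      (fun s hs => (hch s hs).2.2) (fun s hs => (hch s hs).2.1) hS hSb
      (by filter_upwards [hev] with z hz using hy z hz) hyc
  -- `Φ` is an arbitrary selection of end points. Uniqueness forces it to be the chart flow near `c
  -- a`, whatever was selected.
  have hΦe : Φ =ᶠ[𝓝 (c a)] fun q => e.symm (y (e q) b) := by
    have h1 : ContinuousAt e (c a) := e.continuousAt ha
    filter_upwards [h1.eventually hev, e.open_source.mem_nhds ha] with q hq hq'
    have h2 := fun z => h.reaches_iff (z := z) hab hC hq' hq (hy _ hq).1 (hy _ hq).2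
    exact (h2 _).1 (hΦ q ⟨_, (h2 _).2 rfl⟩)
  have hb := hch b (right_mem_Icc.2 hab)
  have h1 := hasMFDerivAt_chart_symm h.mdifferentiable (e.map_source hb.1)
  rw [← hyc] at h1
  have h2 := hd.hasMFDerivAt.comp (c a) (hasMFDerivAt_chart h.mdifferentiable ha)
  have h3 := HasMFDerivAt.comp (c a) (g := e.symm) h1 h2
  rw [← hyc]
  exact h3.congr_of_eventuallyEq hΦe

/-- The first order response of an evolution in a flow box. -/
theorem hasMFDerivAt_perturbed (h : IsFlowBox X e x₀ r C K f f') {a b : ℝ} (hab : a ≤ b)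
    (hC : (C + 1) * (b - a) < r / 2) {γ : ℝ → ℝ → M} {Y : ℝ → ∀ q : M, TangentSpace 𝓘(ℝ, E) q}
    {g : ℝ → E → E} (hg : ContinuousOn (fun p : ℝ × E => g p.1 p.2) (Icc a b ×ˢ closedBall x₀ r))
    (hY : ∀ s ∈ Icc a b, ∀ q ∈ e.source, e q ∈ closedBall x₀ r →
      chartDeriv e q (Y s q) = g s (e q))
    (hc : IsMIntegralCurveOn (γ 0) X (Icc a b))
    (hγ : ∀ᶠ ε in 𝓝[≠] (0 : ℝ), ∀ s ∈ Icc a b,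
      HasVelocityWithinAt (E := E) (γ ε) (X (γ ε s) + ε • Y s (γ ε s)) (Icc a b) s)
    (ha : γ 0 a ∈ e.source) (ha' : e (γ 0 a) ∈ ball x₀ (r / 2)) {S : ℝ → E →L[ℝ] E}
    (hS : ∀ s ∈ Icc a b, HasDerivWithinAt S (-(S s ∘L f' (e (γ 0 s)))) (Icc a b) s)
    (hSb : S b = ContinuousLinearMap.id ℝ E) {δ : E}
    (hδ : HasMFDerivAt 𝓘(ℝ, ℝ) 𝓘(ℝ, E) (fun ε => γ ε a) 0
      ((1 : ℝ →L[ℝ] ℝ).smulRight δ : ℝ →L[ℝ] E)) :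
    HasMFDerivAt 𝓘(ℝ, ℝ) 𝓘(ℝ, E) (fun ε => γ ε b) 0
      ((1 : ℝ →L[ℝ] ℝ).smulRight (chartSymmDeriv e (e (γ 0 b))
        (S a (chartDeriv e (γ 0 a) δ) + ∫ s in a..b, S s (g s (e (γ 0 s))))) : ℝ →L[ℝ] E) := by
  have : CompleteSpace E := FiniteDimensional.complete ℝ E
  have : ProperSpace E := FiniteDimensional.proper ℝ E
  have hC0 := h.nonneg
  have hC' : C * (b - a) < r / 2 := by nlinarith
  have hch := h.chart_integralCurve hC' hc ha (ball_subset_closedBall ha')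
  have hb := hch b (right_mem_Icc.2 hab)
  have hcpt : IsCompact (Icc a b ×ˢ closedBall x₀ r) :=
    isCompact_Icc.prod (isCompact_closedBall x₀ r)
  obtain ⟨G, hG⟩ := hcpt.exists_bound_of_continuousOn hg
  have hca : ContinuousAt (fun ε => γ ε a) 0 := hδ.continuousAt
  have hstart : ∀ᶠ ε in 𝓝[≠] (0 : ℝ), γ ε a ∈ e.source ∩ e ⁻¹' ball x₀ (r / 2) :=
    (hca.eventually_mem ((e.isOpen_inter_preimage isOpen_ball).mem_nhds ⟨ha, ha'⟩)).filter_mono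
      nhdsWithin_le_nhds
  -- For such `ε` the perturbed speed is below `C + 1`, the constant in the assumption on `b - a`.
  have hsmall : ∀ᶠ ε in 𝓝[≠] (0 : ℝ), |ε| * |G| < 1 := by
    have h1 : Tendsto (fun ε : ℝ => |ε| * |G|) (𝓝 0) (𝓝 (|(0 : ℝ)| * |G|)) :=
      (continuous_abs.mul continuous_const).tendsto _
    rw [abs_zero, zero_mul] at h1
    exact (h1.eventually_lt_const one_pos).filter_mono nhdsWithin_le_nhds
  have hsol : ∀ᶠ ε in 𝓝[≠] (0 : ℝ), ∀ s ∈ Icc a b, γ ε s ∈ e.source ∧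
      e (γ ε s) ∈ closedBall x₀ r ∧ HasDerivWithinAt (fun u => e (γ ε u))
        (f (e (γ ε s)) + ε • g s (e (γ ε s))) (Icc a b) s := by
    filter_upwards [hγ, hstart, hsmall] with ε h1 h2 h3
    refine chart_curve_mem_closedBall h.mdifferentiable h.ball_subset hC (by linarith)
      (h := fun s z => f z + ε • g s z) h1 (fun s hs h4 h5 => ⟨?_, ?_⟩) h2.1
      (ball_subset_closedBall h2.2)
    · have h6 := (chartDeriv e (γ ε s)).map_add (X (γ ε s)) (ε • Y s (γ ε s))
      have h7 := (chartDeriv e (γ ε s)).map_smul ε (Y s (γ ε s))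
      refine h6.trans ?_
      rw [← hY s hs _ h4 h5, ← h.field_eq _ h4 h5]
      exact congrArg _ h7
    · refine (norm_add_le _ _).trans (add_le_add (h.norm_le _ h5) ?_)
      rw [norm_smul, Real.norm_eq_abs]
      refine le_trans ?_ h3.le
      exact mul_le_mul_of_nonneg_left ((hG (s, e (γ ε s)) ⟨hs, h5⟩).trans (le_abs_self G))
        (abs_nonneg ε)
  have hd := hasDerivAt_perturbed_endpoint (y := fun ε s => e (γ ε s)) (isCompact_closedBall x₀ r)
    (convex_closedBall x₀ r) h.hasFDerivWithinAt h.continuousOn hab hg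
    (fun s hs => (hch s hs).2.2) (fun s hs => (hch s hs).2.1) hS hSb
    (hsol.mono fun ε hε s hs => ⟨(hε s hs).2.2, (hε s hs).2.1⟩)
    (HasMFDerivAt.hasDerivAt_chart h.mdifferentiable hδ ha)
  have h1 := HasDerivAt.hasMFDerivAt_chart_symm h.mdifferentiable hd (e.map_source hb.1)
  refine h1.congr_of_eventuallyEq ?_
  have h2 : ∀ᶠ ε in 𝓝[≠] (0 : ℝ), γ ε b = e.symm (e (γ ε b)) := by
    filter_upwards [hsol] with ε hε
    rw [e.left_inv (hε b (right_mem_Icc.2 hab)).1]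
  have h3 := eventually_nhdsWithin_iff.1 h2
  filter_upwards [h3] with ε hε
  by_cases h0 : ε = 0
  · rw [h0, e.left_inv hb.1]
  · exact hε h0

end IsFlowBox

end FlowBoxes

/-! ### The linear response formula, continued along the free trajectory. -/

section LinearResponse

open Metric
open scoped NNReal

theorem eventually_nhds_chart_symm {E M : Type*} [TopologicalSpace E] [TopologicalSpace M]
    {e : OpenPartialHomeomorph M E} {p : M} (hp : p ∈ e.source)
    {Q : M → Prop} (hQ : ∀ᶠ q in 𝓝 p, Q q) : ∀ᶠ z in 𝓝 (e p), Q (e.symm z) := by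
  have h := e.continuousAt_symm (e.map_source hp)
  rw [ContinuousAt, e.left_inv hp] at h
  exact h.eventually hQ

variable {E : Type*} [NormedAddCommGroup E] [NormedSpace ℝ E]
  {M : Type*} [TopologicalSpace M] [ChartedSpace E M]

/-- The source `Y s` at the point `c s`, transported to the time `b` by the linearized flow. -/
noncomputable def transportedSource (Φ : ℝ → M → M) (Y : ℝ → ∀ q : M, TangentSpace 𝓘(ℝ, E) q)
    (c : ℝ → M) (b s : ℝ) : E :=
  (mfderiv 𝓘(ℝ, E) 𝓘(ℝ, E) (Φ (b - s)) (c s) : TangentSpace 𝓘(ℝ, E) (c s) →L[ℝ] E) (Y s (c s))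

/-- The linear response formula at the time `b`, together with what is needed to extend it to later
times. -/
structure HasLinearResponse (X : ∀ q : M, TangentSpace 𝓘(ℝ, E) q) (Φ : ℝ → M → M)
    (Y : ℝ → ∀ q : M, TangentSpace 𝓘(ℝ, E) q) (γ : ℝ → ℝ → M) (t₀ b : ℝ) : Prop where
  existsUnique_reaches : ∀ s ∈ Icc t₀ b, ∀ᶠ q in 𝓝 (γ 0 s), ∃! z, Reaches X (b - s) q z
  mdifferentiableAt : ∀ s ∈ Icc t₀ b,
    MDifferentiableAt 𝓘(ℝ, E) 𝓘(ℝ, E) (Φ (b - s)) (γ 0 s)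
  intervalIntegrable : IntervalIntegrable (transportedSource Φ Y (γ 0) b) volume t₀ b
  hasMFDerivAt : HasMFDerivAt 𝓘(ℝ, ℝ) 𝓘(ℝ, E) (fun ε => γ ε b) 0
    ((1 : ℝ →L[ℝ] ℝ).smulRight (∫ s in t₀..b, transportedSource Φ Y (γ 0) b s) : ℝ →L[ℝ] E)

variable {X : ∀ q : M, TangentSpace 𝓘(ℝ, E) q} {Φ : ℝ → M → M}
  {Y : ℝ → ∀ q : M, TangentSpace 𝓘(ℝ, E) q} {γ : ℝ → ℝ → M} {t₀ t : ℝ}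

/-- The start of the continuation: near the initial point `Φ` at time zero is the identity, the
family is constant there and the integral is empty. -/
theorem hasLinearResponse_self
    (hΦ : ∀ τ q, 0 ≤ τ → (∃ z, Reaches X τ q z) → Reaches X τ q (Φ τ q))
    (hex : ∀ᶠ q in 𝓝 (γ 0 t₀), ∃! z, Reaches X (t₀ - t₀) q z)
    (hγ : ∀ᶠ ε in 𝓝[≠] (0 : ℝ), γ ε t₀ = γ 0 t₀) : HasLinearResponse X Φ Y γ t₀ t₀ := by
  have hs : ∀ s ∈ Icc t₀ t₀, s = t₀ := fun s hs => le_antisymm hs.2 hs.1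
  refine ⟨fun s h => ?_, fun s h => ?_, IntervalIntegrable.refl, ?_⟩
  · rw [hs s h]
    exact hex
  · rw [hs s h]
    have hid : Φ (t₀ - t₀) =ᶠ[𝓝 (γ 0 t₀)] id := by
      filter_upwards [hex] with q hq
      obtain ⟨c, h0, -, h1⟩ := hΦ _ q (sub_self t₀).symm.le hq.exists
      rw [← h1, sub_self, h0, id]
    exact mdifferentiableAt_id.congr_of_eventuallyEq hid
  · have h1 : (fun ε => γ ε t₀) =ᶠ[𝓝 0] fun _ => γ 0 t₀ := by
      have h2 := eventually_nhdsWithin_iff.1 hγ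
      filter_upwards [h2] with ε hε
      by_cases h0 : ε = 0
      · rw [h0]
      · exact hε h0
    have h3 := (hasMFDerivAt_const (I := 𝓘(ℝ, ℝ)) (I' := 𝓘(ℝ, E)) (γ 0 t₀) (0 : ℝ))
    refine (h3.congr_of_eventuallyEq h1).congr_mfderiv ?_
    rw [intervalIntegral.integral_same]
    have h4 : (0 : ℝ →L[ℝ] E) = (1 : ℝ →L[ℝ] ℝ).smulRight (0 : E) := by
      ext
      simp
    exact h4

variable [FiniteDimensional ℝ E] [T2Space M]

/-- One step of the continuation. For sources before `a`, the transport to `b` is the transport to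
`a` followed by the linear map `L = dΦ_{b-a}`; for sources in `[a, b]` it is the adjoint resolvent
in the chart. The local response formula, started with the deviation accumulated at `a`, adds up the
two contributions. -/
theorem IsFlowBox.hasLinearResponse_of_le {e : OpenPartialHomeomorph M E}
    {x₀ : E} {r C : ℝ} {K : ℝ≥0} {f : E → E} {f' : E → E →L[ℝ] E}
    (h : IsFlowBox X e x₀ r C K f f') {g : ℝ → E → E} {a b : ℝ}
    (hta : t₀ ≤ a) (hab : a ≤ b) (hbt : b ≤ t) (hC : (C + 1) * (b - a) < r / 2)
    (hK : 2 * K * (b - a) ≤ 1)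
    (hg : ContinuousOn (fun p : ℝ × E => g p.1 p.2) (Icc t₀ t ×ˢ closedBall x₀ r))
    (hY : ∀ s ∈ Icc t₀ t, ∀ q ∈ e.source, e q ∈ closedBall x₀ r →
      chartDeriv e q (Y s q) = g s (e q))
    (hc : IsMIntegralCurveOn (γ 0) X (Icc t₀ t))
    (hγ : ∀ᶠ ε in 𝓝[≠] (0 : ℝ), ∀ s ∈ Icc t₀ t,
      HasVelocityWithinAt (E := E) (γ ε) (X (γ ε s) + ε • Y s (γ ε s)) (Icc t₀ t) s)
    (hmem : ∀ s ∈ Icc a b, γ 0 s ∈ e.source ∧ e (γ 0 s) ∈ ball x₀ (r / 2))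
    (hΦ : ∀ τ q, 0 ≤ τ → (∃ z, Reaches X τ q z) → Reaches X τ q (Φ τ q))
    (hR : HasLinearResponse X Φ Y γ t₀ a) : HasLinearResponse X Φ Y γ t₀ b := by
  have : CompleteSpace E := FiniteDimensional.complete ℝ E
  have hC0 := h.nonneg
  have hIcc : Icc a b ⊆ Icc t₀ t := Icc_subset_Icc hta hbt
  have haI : a ∈ Icc a b := left_mem_Icc.2 hab
  have hcab := hc.mono hIcc
  have hC' : ∀ s ∈ Icc a b, C * (b - s) < r / 2 := fun s hs => by nlinarith [hs.1, hs.2]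
  have hball : ∀ s ∈ Icc a b, e (γ 0 s) ∈ closedBall x₀ r := fun s hs =>
    closedBall_subset_closedBall (by linarith [h.pos]) (ball_subset_closedBall (hmem s hs).2)
  have hxc : ContinuousOn (fun s => e (γ 0 s)) (Icc a b) :=
    e.continuousOn.comp hcab.continuousOn fun s hs => (hmem s hs).1
  -- Since `S` is normalized at the final time, its restriction to `[s, b]` is the resolvent for
  -- every starting time `s`; one `S` describes all the differentials `dΦ_{b-s}`.
  obtain ⟨S, hSb, hS⟩ := exists_adjoint_resolvent (A := fun s => f' (e (γ 0 s))) hab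
    (h.continuousOn.comp hxc hball) (fun s hs => h.norm_deriv_le _ (hball s hs)) hK
  have hSc : ContinuousOn S (Icc a b) := fun s hs => (hS s hs).continuousWithinAt
  set P : E →L[ℝ] E := chartSymmDeriv e (e (γ 0 b)) with hP
  have hloc : ∀ s ∈ Icc a b, HasMFDerivAt 𝓘(ℝ, E) 𝓘(ℝ, E) (Φ (b - s)) (γ 0 s)
      (P ∘L S s ∘L chartDeriv e (γ 0 s) : E →L[ℝ] E) := by
    intro s hs
    have hsub : Icc s b ⊆ Icc a b := Icc_subset_Icc_left hs.1
    exact h.hasMFDerivAt_flow hs.2 (hC' s hs) (hcab.mono hsub) (hmem s hs).1 (hmem s hs).2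
      (fun u hu => (hS u (hsub hu)).mono hsub) hSb (fun q => hΦ _ q (sub_nonneg.2 hs.2))
  have hloc' : ∀ s ∈ Icc a b, ∀ᶠ q in 𝓝 (γ 0 s), ∃! z, Reaches X (b - s) q z := by
    intro s hs
    filter_upwards [(e.isOpen_inter_preimage isOpen_ball).mem_nhds (hmem s hs)] with q hq
    exact h.existsUnique_reaches hs.2 (hC' s hs) hq.1 (ball_subset_closedBall hq.2)
  set L : E →L[ℝ] E := P ∘L S a ∘L chartDeriv e (γ 0 a) with hL
  -- The composition law is needed in a neighbourhood of `γ 0 s`, in order to differentiate it.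
  -- Continuity of `Φ (a - s)` at `γ 0 s` brings nearby points to where the second step has a unique
  -- end point.
  have hcomp : ∀ s ∈ Icc t₀ a, ∀ᶠ q in 𝓝 (γ 0 s), (∃! z, Reaches X (b - s) q z) ∧
      Φ (b - s) q = Φ (b - a) (Φ (a - s) q) := by
    intro s hs
    have hΦs : Φ (a - s) (γ 0 s) = γ 0 a := by
      have h1 := (hR.existsUnique_reaches s hs).self_of_nhds
      exact h1.unique (hΦ _ _ (sub_nonneg.2 hs.2) h1.exists)
        (hc.mono (Icc_subset_Icc hs.1 (hab.trans hbt))).reaches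
    have h2 := (hR.mdifferentiableAt s hs).continuousAt
    have h3 : ∀ᶠ q in 𝓝 (Φ (a - s) (γ 0 s)), ∃! z, Reaches X (b - a) q z := by
      rw [hΦs]
      exact hloc' a haI
    filter_upwards [hR.existsUnique_reaches s hs, h2.eventually h3] with q hq1 hq2
    have h4 : b - s = (a - s) + (b - a) := by ring
    have h5 : ∀ z, Reaches X (b - s) q z ↔ Reaches X (b - a) (Φ (a - s) q) z := by
      intro z
      have h6 := hΦ _ q (sub_nonneg.2 hs.2) hq1.exists
      rw [h4, reaches_add (sub_nonneg.2 hs.2) (sub_nonneg.2 hab)]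
      constructor
      · rintro ⟨w, hw, hwz⟩
        rwa [hq1.unique h6 hw]
      · exact fun h7 => ⟨_, h6, h7⟩
    have h8 : ∃! z, Reaches X (b - s) q z := by simpa only [h5] using hq2
    refine ⟨h8, hq2.unique ?_ (hΦ _ _ (sub_nonneg.2 hab) hq2.exists)⟩
    exact (h5 _).1 (hΦ _ q (sub_nonneg.2 (hs.2.trans hab)) h8.exists)
  have hold : ∀ s ∈ Icc t₀ a, HasMFDerivAt 𝓘(ℝ, E) 𝓘(ℝ, E) (Φ (b - s)) (γ 0 s)
      (L ∘L (mfderiv 𝓘(ℝ, E) 𝓘(ℝ, E) (Φ (a - s)) (γ 0 s) : E →L[ℝ] E) : E →L[ℝ] E) := by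
    intro s hs
    have hΦs : Φ (a - s) (γ 0 s) = γ 0 a := by
      have h1 := (hR.existsUnique_reaches s hs).self_of_nhds
      exact h1.unique (hΦ _ _ (sub_nonneg.2 hs.2) h1.exists)
        (hc.mono (Icc_subset_Icc hs.1 (hab.trans hbt))).reaches
    have h1 := (hR.mdifferentiableAt s hs).hasMFDerivAt
    have h2 := hloc a haI
    rw [← hΦs] at h2
    have h3 := HasMFDerivAt.comp (γ 0 s) h2 h1
    rw [hΦs] at h3
    exact h3.congr_of_eventuallyEq ((hcomp s hs).mono fun q hq => hq.2)
  have htr1 : ∀ s ∈ Icc t₀ a, transportedSource Φ Y (γ 0) b s =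
      L (transportedSource Φ Y (γ 0) a s) := by
    intro s hs
    exact DFunLike.congr_fun (hold s hs).mfderiv (Y s (γ 0 s))
  have htr2 : ∀ s ∈ Icc a b, transportedSource Φ Y (γ 0) b s = P (S s (g s (e (γ 0 s)))) := by
    intro s hs
    rw [← hY s (hIcc hs) _ (hmem s hs).1 (hball s hs)]
    exact DFunLike.congr_fun (hloc s hs).mfderiv (Y s (γ 0 s))
  have hgc : ContinuousOn (fun s => S s (g s (e (γ 0 s)))) (Icc a b) :=
    hSc.clm_apply (hg.comp (continuousOn_id.prodMk hxc) fun s hs => ⟨hIcc hs, hball s hs⟩)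
  have hi1 : IntervalIntegrable (transportedSource Φ Y (γ 0) b) volume t₀ a := by
    refine IntervalIntegrable.congr (f := fun s => L (transportedSource Φ Y (γ 0) a s))
      (fun s hs => ?_) ?_
    · rw [uIoc_of_le hta] at hs
      exact (htr1 s (Ioc_subset_Icc_self hs)).symm
    · exact ⟨L.integrable_comp hR.intervalIntegrable.1, L.integrable_comp hR.intervalIntegrable.2⟩
  have hi2' : IntervalIntegrable (fun s => S s (g s (e (γ 0 s)))) volume a b :=
    ContinuousOn.intervalIntegrable (by rwa [uIcc_of_le hab])
  have hi2 : IntervalIntegrable (transportedSource Φ Y (γ 0) b) volume a b := by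
    refine IntervalIntegrable.congr (f := fun s => P (S s (g s (e (γ 0 s))))) (fun s hs => ?_) ?_
    · rw [uIoc_of_le hab] at hs
      exact (htr2 s (Ioc_subset_Icc_self hs)).symm
    · exact ⟨P.integrable_comp hi2'.1, P.integrable_comp hi2'.2⟩
  refine ⟨fun s hs => ?_, fun s hs => ?_, hi1.trans hi2, ?_⟩
  · rcases le_total s a with hsa | has
    · exact (hcomp s ⟨hs.1, hsa⟩).mono fun q hq => hq.1
    · exact hloc' s ⟨has, hs.2⟩
  · rcases le_total s a with hsa | has
    · exact (hold s ⟨hs.1, hsa⟩).mdifferentiableAt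
    · exact (hloc s ⟨has, hs.2⟩).mdifferentiableAt
  · have h1 := h.hasMFDerivAt_perturbed hab hC (Y := Y)
      (hg.mono (prod_mono_left hIcc)) (fun s hs => hY s (hIcc hs)) hcab
      (hγ.mono fun ε hε s hs => (hε s (hIcc hs)).mono hIcc) (hmem a haI).1 (hmem a haI).2 hS hSb
      hR.hasMFDerivAt
    have h2 : ∫ s in t₀..b, transportedSource Φ Y (γ 0) b s =
        P (S a (chartDeriv e (γ 0 a) (∫ s in t₀..a, transportedSource Φ Y (γ 0) a s)) +
          ∫ s in a..b, S s (g s (e (γ 0 s)))) := by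
      rw [← intervalIntegral.integral_add_adjacent_intervals hi1 hi2, map_add]
      congr 1
      · rw [intervalIntegral.integral_congr (g := fun s => L (transportedSource Φ Y (γ 0) a s))
          (fun s hs => htr1 s (by rwa [uIcc_of_le hta] at hs)),
          L.intervalIntegral_comp_comm hR.intervalIntegrable]
        rfl
      · rw [intervalIntegral.integral_congr (g := fun s => P (S s (g s (e (γ 0 s)))))
          (fun s hs => htr2 s (by rwa [uIcc_of_le hab] at hs)),
          P.intervalIntegral_comp_comm hi2']
    rw [h2]
    exact h1

/-- The linear response formula for a vector field `X`, a source `Y` and a flow `Φ` of `X`, if `X`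
is `C¹` and `Y` is continuous in charts near the points of the unperturbed curve. -/
theorem hasLinearResponse (ht : t₀ ≤ t)
    (hΦ : ∀ τ q, 0 ≤ τ → (∃ z, Reaches X τ q z) → Reaches X τ q (Φ τ q))
    (hc : IsMIntegralCurveOn (γ 0) X (Icc t₀ t))
    (hγ : ∀ᶠ ε in 𝓝[≠] (0 : ℝ), (∀ s ∈ Icc t₀ t,
      HasVelocityWithinAt (E := E) (γ ε) (X (γ ε s) + ε • Y s (γ ε s)) (Icc t₀ t) s) ∧
      γ ε t₀ = γ 0 t₀)
    (hloc : ∀ s₀ ∈ Icc t₀ t, ∃ e : OpenPartialHomeomorph M E,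
      e.MDifferentiable 𝓘(ℝ, E) 𝓘(ℝ, E) ∧ γ 0 s₀ ∈ e.source ∧
      ∃ f : E → E, ContDiffAt ℝ 1 f (e (γ 0 s₀)) ∧
        (∀ᶠ q in 𝓝 (γ 0 s₀), chartDeriv e q (X q) = f (e q)) ∧
      ∃ g : ℝ → E → E, (∃ U ∈ 𝓝 (e (γ 0 s₀)),
        ContinuousOn (fun p : ℝ × E => g p.1 p.2) (Icc t₀ t ×ˢ U)) ∧
        ∀ᶠ q in 𝓝 (γ 0 s₀), ∀ s ∈ Icc t₀ t, chartDeriv e q (Y s q) = g s (e q)) :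
    HasLinearResponse X Φ Y γ t₀ t := by
  have : ProperSpace E := FiniteDimensional.proper ℝ E
  -- All local properties hold on one small closed ball, whose compactness supplies the constants
  -- `C` and `K`.
  have hbox : ∀ s₀ ∈ Icc t₀ t, ∃ (e : OpenPartialHomeomorph M E) (r C : ℝ) (K : ℝ≥0) (f : E → E)
      (f' : E → E →L[ℝ] E) (g : ℝ → E → E), γ 0 s₀ ∈ e.source ∧
      IsFlowBox X e (e (γ 0 s₀)) r C K f f' ∧
      ContinuousOn (fun p : ℝ × E => g p.1 p.2) (Icc t₀ t ×ˢ closedBall (e (γ 0 s₀)) r) ∧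
      ∀ s ∈ Icc t₀ t, ∀ q ∈ e.source, e q ∈ closedBall (e (γ 0 s₀)) r →
        chartDeriv e q (Y s q) = g s (e q) := by
    intro s₀ hs₀
    obtain ⟨e, he, hs, f, hf, hX, g, ⟨U, hU, hg⟩, hY⟩ := hloc s₀ hs₀
    have hev : ∀ᶠ z in 𝓝 (e (γ 0 s₀)), z ∈ e.target ∧ z ∈ U ∧ ContDiffAt ℝ 1 f z ∧
        chartDeriv e (e.symm z) (X (e.symm z)) = f (e (e.symm z)) ∧
        ∀ s ∈ Icc t₀ t, chartDeriv e (e.symm z) (Y s (e.symm z)) = g s (e (e.symm z)) := by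
      filter_upwards [e.open_target.mem_nhds (e.map_source hs), hU, hf.eventually (by simp),
        eventually_nhds_chart_symm hs hX, eventually_nhds_chart_symm hs hY] with z h1 h2 h3 h4 h5
      exact ⟨h1, h2, h3, h4, h5⟩
    obtain ⟨r, hr, hball⟩ := nhds_basis_closedBall.mem_iff.1 hev
    have hd : ∀ z ∈ closedBall (e (γ 0 s₀)) r,
        HasFDerivWithinAt f (fderiv ℝ f z) (closedBall (e (γ 0 s₀)) r) z := fun z hz =>
      ((hball hz).2.2.1.differentiableAt one_ne_zero).hasFDerivAt.hasFDerivWithinAt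
    have hd' : ContinuousOn (fderiv ℝ f) (closedBall (e (γ 0 s₀)) r) := fun z hz =>
      ((hball hz).2.2.1.fderiv_right (m := 0) (by simp)).continuousAt.continuousWithinAt
    obtain ⟨K, hK, hK'⟩ := exists_lipschitzOnWith_of_continuousOn_deriv
      (isCompact_closedBall _ r) (convex_closedBall _ r) hd hd'
    obtain ⟨C, hC⟩ := (isCompact_closedBall (e (γ 0 s₀)) r).exists_bound_of_continuousOn
      hK.continuousOn
    have hC0 : 0 ≤ C := (norm_nonneg _).trans (hC _ (mem_closedBall_self hr.le))
    refine ⟨e, r, C, K, f, fderiv ℝ f, g, hs, ⟨he, fun z hz => (hball hz).1, fun q hq hq' => ?_, hd,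
      hd', hK, hC, hK', hr, hC0⟩, hg.mono (prod_mono_right fun z hz => (hball hz).2.1),
      fun s hst q hq hq' => ?_⟩
    · have h1 := (hball hq').2.2.2.1
      rwa [e.left_inv hq] at h1
    · have h1 := (hball hq').2.2.2.2 s hst
      rwa [e.left_inv hq] at h1
  have hstep : ∀ s₀ : Icc t₀ t, ∃ δ > 0, ∀ a b : Icc t₀ t, a ≤ b →
      (∀ s : Icc t₀ t, s ∈ Icc a b → s ∈ ball s₀ δ) →
      HasLinearResponse X Φ Y γ t₀ a → HasLinearResponse X Φ Y γ t₀ b := by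
    rintro ⟨s₀, hs₀⟩
    obtain ⟨e, r, C, K, f, f', g, hs, h, hg, hY⟩ := hbox s₀ hs₀
    have hr := h.pos
    have hC0 := h.nonneg
    have h1 : ∀ᶠ u in 𝓝[Icc t₀ t] s₀, γ 0 u ∈ e.source ∩ e ⁻¹' ball (e (γ 0 s₀)) (r / 2) :=
      (hc.continuousOn s₀ hs₀).eventually_mem ((e.isOpen_inter_preimage isOpen_ball).mem_nhds
        ⟨hs, mem_ball_self (by positivity)⟩)
    obtain ⟨δ₁, hδ₁, h2⟩ := Metric.mem_nhdsWithin_iff.1 h1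
    -- Intervals in a `δ`-ball are shorter than `2 δ`: the second bound gives `(C + 1) * (b - a) ≤ r
    -- / 4`, the third `2 * (K + 1) * (b - a) ≤ 1 / 2`. The first keeps the free trajectory in the
    -- half ball.
    set δ := min δ₁ (min (r / (8 * (C + 1))) (1 / (8 * (K + 1)))) with hδ
    have hK0 : (0 : ℝ) ≤ K := K.2
    have hδ0 : 0 < δ := lt_min hδ₁ (lt_min (by positivity) (by positivity))
    refine ⟨δ, hδ0, fun a b hab hsub => ?_⟩
    have ha := hsub a ⟨le_rfl, hab⟩
    have hb := hsub b ⟨hab, le_rfl⟩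
    have hba : (b : ℝ) - a < 2 * δ := by
      rw [mem_ball, Subtype.dist_eq, Real.dist_eq, abs_lt] at ha hb
      linarith [ha.1, hb.2]
    refine h.hasLinearResponse_of_le a.2.1 hab b.2.2 ?_ ?_ hg hY hc (hγ.mono fun ε hε => hε.1)
      (fun s hsab => ?_) hΦ
    · have h3 : δ ≤ r / (8 * (C + 1)) := (min_le_right _ _).trans (min_le_left _ _)
      have h4 : (C + 1) * (2 * (r / (8 * (C + 1)))) = r / 4 := by field_simp; norm_num
      have h5 : (C + 1) * ((b : ℝ) - a) ≤ (C + 1) * (2 * (r / (8 * (C + 1)))) :=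
        mul_le_mul_of_nonneg_left (by linarith) (by linarith)
      linarith
    · have h3 : δ ≤ 1 / (8 * (K + 1)) := (min_le_right _ _).trans (min_le_right _ _)
      have h4 : 2 * ((K : ℝ) + 1) * (2 * (1 / (8 * (K + 1)))) = 1 / 2 := by field_simp; norm_num
      have hba0 : 0 ≤ (b : ℝ) - a := sub_nonneg.2 hab
      have h5 : 2 * ((K : ℝ) + 1) * ((b : ℝ) - a) ≤ 2 * ((K : ℝ) + 1) * (2 * (1 / (8 * (K + 1)))) :=
        mul_le_mul_of_nonneg_left (by linarith) (by linarith)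
      nlinarith
    · have hst : s ∈ Icc t₀ t := ⟨a.2.1.trans hsab.1, hsab.2.trans b.2.2⟩
      have h3 := hsub ⟨s, hst⟩ ⟨hsab.1, hsab.2⟩
      exact h2 ⟨ball_subset_ball (min_le_left _ _) h3, hst⟩
  choose δ hδ hstep using hstep
  -- A finite subdivision of `[t₀, t]`, each piece inside one of the balls; the response is
  -- continued piece by piece.
  obtain ⟨u, hu0, hmono, ⟨m, hm⟩, hcov⟩ := exists_monotone_Icc_subset_open_cover_Icc ht
    (c := fun s₀ : Icc t₀ t => ball s₀ (δ s₀)) (fun _ => isOpen_ball)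
    (fun s _ => mem_iUnion.2 ⟨s, mem_ball_self (hδ s)⟩)
  have hall : ∀ n, HasLinearResponse X Φ Y γ t₀ (u n) := by
    intro n
    induction n with
    | zero =>
      rw [hu0]
      obtain ⟨e, r, C, K, f, f', g, hs, h, -, -⟩ := hbox t₀ (left_mem_Icc.2 ht)
      have hr := h.pos
      refine hasLinearResponse_self hΦ ?_ (hγ.mono fun ε hε => hε.2)
      filter_upwards [(e.isOpen_inter_preimage isOpen_ball).mem_nhds
        (⟨hs, mem_ball_self (half_pos hr)⟩ : γ 0 t₀ ∈ e.source ∩ e ⁻¹' ball (e (γ 0 t₀)) (r / 2))]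
        with q hq
      exact h.existsUnique_reaches le_rfl (by simpa using half_pos hr) hq.1
        (ball_subset_closedBall hq.2)
    | succ n ih =>
      obtain ⟨i, hi⟩ := hcov n
      exact hstep i (u n) (u (n + 1)) (hmono n.le_succ) (fun s hs => hi hs) ih
  have := hall m
  rwa [hm m le_rfl] at this

end LinearResponse

/-! ### Independence of the representatives; linearity of the pseudo-inverse. -/

section LiftsInCharts

variable {H : Type*} [NormedAddCommGroup H] [InnerProductSpace ℂ H]
  {E : Type*} [NormedAddCommGroup E] [NormedSpace ℝ E]
  {M : Type*} [TopologicalSpace M] [ChartedSpace E M]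

theorem projPerp_apply (ψ w : H) : projPerp ψ w = w - (⟪ψ, w⟫_ℂ / ⟪ψ, ψ⟫_ℂ) • ψ := rfl

theorem projPerp_self {ψ : H} (hψ : ψ ≠ 0) : projPerp ψ ψ = 0 := by
  rw [projPerp_apply, div_self (inner_self_ne_zero.2 hψ), one_smul, sub_self]

theorem projPerp_smul {c : ℂ} (hc : c ≠ 0) (ψ : H) : projPerp (c • ψ) = projPerp ψ := by
  ext w
  rw [projPerp_apply, projPerp_apply, inner_smul_left, inner_smul_left, inner_smul_right, smul_smul]
  have hc' : (starRingEnd ℂ) c ≠ 0 := (map_ne_zero _).2 hc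
  congr 2
  by_cases h : ⟪ψ, ψ⟫_ℂ = 0
  · rw [h]
    simp only [mul_zero, div_zero, zero_mul]
  · field_simp

/-- Rescaling the representatives of a differentiable family of states by a function rescales the
horizontal part of its derivative. -/
theorem exists_projPerp_fderiv_eq_smul {Φ Ψ : E → H} {z : E} (hΦ : DifferentiableAt ℝ Φ z)
    (hΨ : DifferentiableAt ℝ Ψ z) (hΦ0 : Φ z ≠ 0) (hΨ0 : Ψ z ≠ 0)
    (h : ∀ᶠ y in 𝓝 z, ∃ c : ℂ, Ψ y = c • Φ y) :
    ∃ c : ℂ, c ≠ 0 ∧ Ψ z = c • Φ z ∧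
      ∀ a, projPerp (Ψ z) (fderiv ℝ Ψ z a) = c • projPerp (Φ z) (fderiv ℝ Φ z a) := by
  -- The proportionality factor is recovered from inner products, which shows that it is
  -- differentiable. Its derivative contributes a multiple of `Φ z`, which the projector kills.
  let c : E → ℂ := fun y => ⟪Φ y, Ψ y⟫_ℂ / ⟪Φ y, Φ y⟫_ℂ
  have hne : ∀ᶠ y in 𝓝 z, Φ y ≠ 0 := hΦ.continuousAt.eventually_ne hΦ0
  have hc : Ψ =ᶠ[𝓝 z] fun y => c y • Φ y := by
    filter_upwards [h, hne] with y ⟨d, hd⟩ hy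
    have h1 : c y = d := by
      simp only [c]
      rw [hd, inner_smul_right, mul_div_assoc, div_self (inner_self_ne_zero.2 hy), mul_one]
    rw [h1, hd]
  have hcd : DifferentiableAt ℝ c z :=
    (hΦ.inner ℂ hΨ).mul ((hΦ.inner ℂ hΦ).inv (inner_self_ne_zero.2 hΦ0))
  have hz : Ψ z = c z • Φ z := hc.eq_of_nhds
  have hcz : c z ≠ 0 := by
    intro h0
    rw [h0, zero_smul] at hz
    exact hΨ0 hz
  refine ⟨c z, hcz, hz, fun a => ?_⟩
  have h2 : fderiv ℝ Ψ z a = c z • fderiv ℝ Φ z a + fderiv ℝ c z a • Φ z := by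
    have h3 : HasFDerivAt (fun y => c y • Φ y) _ z := hcd.hasFDerivAt.smul hΦ.hasFDerivAt
    rw [hc.fderiv_eq, h3.fderiv]
    rfl
  rw [h2, hz, projPerp_smul hcz, map_add, map_smul, map_smul, projPerp_self hΦ0, smul_zero, add_zero]

theorem mdifferentiableAt_chart_symm_comp {F : Type*} [NormedAddCommGroup F] [NormedSpace ℝ F]
    {e : OpenPartialHomeomorph M E} (he : e.MDifferentiable 𝓘(ℝ, E) 𝓘(ℝ, E)) {q : M}
    (hq : q ∈ e.source) {f : M → F} (hf : MDifferentiableAt 𝓘(ℝ, E) 𝓘(ℝ, F) f q) :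
    DifferentiableAt ℝ (fun z => f (e.symm z)) (e q) := by
  rw [← e.left_inv hq] at hf
  have h := MDifferentiableAt.comp (e q) hf (he.mdifferentiableAt_symm (e.map_source hq))
  exact mdifferentiableAt_iff_differentiableAt.1 h

theorem mfderiv_eq_fderiv_chart {F : Type*} [NormedAddCommGroup F] [NormedSpace ℝ F]
    {e : OpenPartialHomeomorph M E} (he : e.MDifferentiable 𝓘(ℝ, E) 𝓘(ℝ, E)) {q : M}
    (hq : q ∈ e.source) {f : M → F} (hf : MDifferentiableAt 𝓘(ℝ, E) 𝓘(ℝ, F) f q) :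
    (mfderiv 𝓘(ℝ, E) 𝓘(ℝ, F) f q : E →L[ℝ] F) =
      fderiv ℝ (fun z => f (e.symm z)) (e q) ∘L chartDeriv e q := by
  have h1 := (mdifferentiableAt_chart_symm_comp he hq hf).hasFDerivAt.hasMFDerivAt.comp q
    (hasMFDerivAt_chart he hq)
  refine (h1.congr_of_eventuallyEq ?_).mfderiv
  filter_upwards [e.open_source.mem_nhds hq] with y hy
  simp [e.left_inv hy]

variable {state : M → ℙ ℂ H} {φ ψ : M → H} {q : M}

theorem IsLift.mdifferentiableAt (h : IsLift (E := E) state φ q) :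
    MDifferentiableAt 𝓘(ℝ, E) 𝓘(ℝ, H) φ q :=
  h.self_of_nhds.1.mdifferentiableAt (by simp)

theorem IsLift.ne_zero (h : IsLift (E := E) state φ q) : φ q ≠ 0 := h.self_of_nhds.2.1

theorem IsLift.eventually (h : IsLift (E := E) state φ q) :
    ∀ᶠ y in 𝓝 q, IsLift (E := E) state φ y :=
  eventually_eventually_nhds.2 h

theorem frame_eq_fderiv_chart {e : OpenPartialHomeomorph M E}
    (he : e.MDifferentiable 𝓘(ℝ, E) 𝓘(ℝ, E)) (hq : q ∈ e.source)
    (h : IsLift (E := E) state φ q) (u : TangentSpace 𝓘(ℝ, E) q) :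
    frame (E := E) φ q u =
      projPerp (φ q) (fderiv ℝ (fun z => φ (e.symm z)) (e q) (chartDeriv e q u)) := by
  have h1 := DFunLike.congr_fun (mfderiv_eq_fderiv_chart he hq h.mdifferentiableAt) u
  exact congrArg (projPerp (φ q)) h1

/-- Two choices of representatives have proportional frames. -/
theorem IsLift.exists_frame_eq_smul [IsManifold 𝓘(ℝ, E) 1 M] (hφ : IsLift (E := E) state φ q)
    (hψ : IsLift (E := E) state ψ q) : ∃ c : ℂ, c ≠ 0 ∧ ψ q = c • φ q ∧
      ∀ u, frame (E := E) ψ q u = c • frame (E := E) φ q u := by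
  have he : (chartAt E q).MDifferentiable 𝓘(ℝ, E) 𝓘(ℝ, E) := mdifferentiable_chart q
  have hq := mem_chart_source E q
  set e := chartAt E q
  have h : ∀ᶠ y in 𝓝 q, ∃ c : ℂ, ψ y = c • φ y := by
    filter_upwards [Filter.Eventually.and hφ hψ] with y ⟨⟨_, h1, h2⟩, _, h3, h4⟩
    obtain ⟨c, hc⟩ := (Projectivization.mk_eq_mk_iff' ℂ _ _ h3 h1).1 (h4.trans h2.symm)
    exact ⟨c, hc.symm⟩
  obtain ⟨c, hc, hc1, hc2⟩ := exists_projPerp_fderiv_eq_smul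
    (mdifferentiableAt_chart_symm_comp he hq hφ.mdifferentiableAt)
    (mdifferentiableAt_chart_symm_comp he hq hψ.mdifferentiableAt)
    (by rw [e.left_inv hq]; exact hφ.ne_zero) (by rw [e.left_inv hq]; exact hψ.ne_zero)
    (eventually_nhds_chart_symm hq h)
  rw [e.left_inv hq] at hc1 hc2
  refine ⟨c, hc, hc1, fun u => ?_⟩
  rw [frame_eq_fderiv_chart he hq hφ, frame_eq_fderiv_chart he hq hψ, hc2]

namespace VariationalManifold

variable (V : VariationalManifold H E M)

theorem isLift_lift (x : M) : IsLift (E := E) V.state (V.lift x) x := (V.exists_lift x).choose_spec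

theorem inner_smul_div_norm_sq {c : ℂ} (hc : c ≠ 0) (a b ψ : H) (hψ : ψ ≠ 0) :
    (⟪c • a, c • b⟫_ℂ).re / ‖c • ψ‖ ^ 2 = (⟪a, b⟫_ℂ).re / ‖ψ‖ ^ 2 ∧
    (⟪c • a, c • b⟫_ℂ).im / ‖c • ψ‖ ^ 2 = (⟪a, b⟫_ℂ).im / ‖ψ‖ ^ 2 := by
  have h1 : ⟪c • a, c • b⟫_ℂ = ((‖c‖ ^ 2 : ℝ) : ℂ) * ⟪a, b⟫_ℂ := by
    rw [inner_smul_left, inner_smul_right, ← mul_assoc, Complex.conj_mul']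
    push_cast
    rfl
  have hc' : ‖c‖ ≠ 0 := norm_ne_zero_iff.2 hc
  have hψ' : ‖ψ‖ ≠ 0 := norm_ne_zero_iff.2 hψ
  rw [h1, Complex.re_ofReal_mul, Complex.im_ofReal_mul, norm_smul]
  constructor <;> field_simp

/-- `V.lift q` is chosen separately for each `q`, without any continuity in `q`. As frames and
representatives scale by the same factor, a single lift can be used at all points near a given one.
-/
theorem metric_eq [IsManifold 𝓘(ℝ, E) 1 M] (h : IsLift (E := E) V.state φ q)
    (u v : TangentSpace 𝓘(ℝ, E) q) : V.metric q u v =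
      2 * ((⟪frame (E := E) φ q u, frame (E := E) φ q v⟫_ℂ).re / ‖φ q‖ ^ 2) := by
  obtain ⟨c, hc, h1, h2⟩ := h.exists_frame_eq_smul (V.isLift_lift q)
  rw [← (inner_smul_div_norm_sq hc _ _ _ h.ne_zero).1, ← h1, ← h2, ← h2, ← mul_div_assoc]
  rfl

theorem symp_eq [IsManifold 𝓘(ℝ, E) 1 M] (h : IsLift (E := E) V.state φ q)
    (u v : TangentSpace 𝓘(ℝ, E) q) : V.symp q u v =
      2 * ((⟪frame (E := E) φ q u, frame (E := E) φ q v⟫_ℂ).im / ‖φ q‖ ^ 2) := by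
  obtain ⟨c, hc, h1, h2⟩ := h.exists_frame_eq_smul (V.isLift_lift q)
  rw [← (inner_smul_div_norm_sq hc _ _ _ h.ne_zero).2, ← h1, ← h2, ← h2, ← mul_div_assoc]
  rfl

theorem metric_symm (x : M) (u v : TangentSpace 𝓘(ℝ, E) x) : V.metric x u v = V.metric x v u := by
  simp only [metric, LinearMap.mk₂_apply]
  rw [← inner_conj_symm, Complex.conj_re]

theorem metric_pos (x : M) (u : TangentSpace 𝓘(ℝ, E) x) (hu : u ≠ 0) : 0 < V.metric x u u := by
  simp only [metric, LinearMap.mk₂_apply]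
  have h1 : frame (V.lift x) x u ≠ 0 := fun h =>
    hu (V.immersion x _ (V.isLift_lift x) (by rw [h, map_zero]))
  have h2 : 0 < (⟪frame (V.lift x) x u, frame (V.lift x) x u⟫_ℂ).re := by
    rw [← RCLike.re_eq_complex_re, inner_self_eq_norm_sq]
    exact pow_pos (norm_pos_iff.2 h1) 2
  have h3 : 0 < ‖V.lift x x‖ := norm_pos_iff.2 (V.isLift_lift x).ne_zero
  positivity

theorem symp_antisymm (x : M) (u v : TangentSpace 𝓘(ℝ, E) x) : V.symp x u v = - V.symp x v u := by
  simp only [symp, LinearMap.mk₂_apply]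
  rw [← inner_conj_symm, Complex.conj_im]
  ring

theorem dExpect_eq_fderiv_chart {e : OpenPartialHomeomorph M E}
    (he : e.MDifferentiable 𝓘(ℝ, E) 𝓘(ℝ, E)) {q : M} (hq : q ∈ e.source) {A : H →ₗ.[ℂ] H}
    (hA : MDifferentiableAt 𝓘(ℝ, E) 𝓘(ℝ, ℝ) (V.expect A) q) (u : E) :
    V.dExpect A q u = fderiv ℝ (fun z => V.expect A (e.symm z)) (e q) (chartDeriv e q u) :=
  DFunLike.congr_fun (mfderiv_eq_fderiv_chart he hq hA) u

variable [FiniteDimensional ℝ E]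

theorem isPseudoInverseAt_Omega (x : M) (α : Module.Dual ℝ (TangentSpace 𝓘(ℝ, E) x)) :
    IsPseudoInverseAt (V.metric x) (V.symp x) α (V.Omega x α) := by
  have h := (V.existsUnique_omega x α).exists
  rw [Omega, pseudoInverse, dif_pos h]
  exact h.choose_spec

theorem Omega_eq {x : M} {α : Module.Dual ℝ (TangentSpace 𝓘(ℝ, E) x)} {u : TangentSpace 𝓘(ℝ, E) x}
    (h : IsPseudoInverseAt (V.metric x) (V.symp x) α u) : V.Omega x α = u :=
  (V.existsUnique_omega x α).unique (V.isPseudoInverseAt_Omega x α) h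

/-- The conditions that define the pseudo-inverse are linear in the pair of covector and vector, and
determine the vector uniquely. -/
theorem Omega_add (x : M) (α β : Module.Dual ℝ (TangentSpace 𝓘(ℝ, E) x)) :
    V.Omega x (α + β) = V.Omega x α + V.Omega x β := by
  obtain ⟨h1, h2⟩ := V.isPseudoInverseAt_Omega x α
  obtain ⟨h3, h4⟩ := V.isPseudoInverseAt_Omega x β
  refine V.Omega_eq ⟨fun v hv => ?_, fun u hu => ?_⟩
  · rw [map_add, h1 v hv, h3 v hv, add_zero]
  · rw [map_add, h2 u hu, h4 u hu, LinearMap.add_apply]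

theorem Omega_smul (x : M) (c : ℝ) (α : Module.Dual ℝ (TangentSpace 𝓘(ℝ, E) x)) :
    V.Omega x (c • α) = c • V.Omega x α := by
  obtain ⟨h1, h2⟩ := V.isPseudoInverseAt_Omega x α
  refine V.Omega_eq ⟨fun v hv => ?_, fun u hu => ?_⟩
  · rw [map_smul, h1 v hv, smul_zero]
  · rw [map_smul, h2 u hu, LinearMap.smul_apply]

end VariationalManifold

end LiftsInCharts

/-! ### Regularity of the forms, the pseudo-inverse and the differentials in charts. -/

section FieldsInCharts

theorem contDiffAt_clm_of_apply {D E F : Type*} [NormedAddCommGroup D] [NormedSpace ℝ D]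
    [NormedAddCommGroup E] [NormedSpace ℝ E] [FiniteDimensional ℝ E] [NormedAddCommGroup F]
    [NormedSpace ℝ F] {n : WithTop ℕ∞} {f : D → E →L[ℝ] F} {x : D}
    (h : ∀ y, ContDiffAt ℝ n (fun x => f x y) x) : ContDiffAt ℝ n f x := by
  let d := Module.finrank ℝ E
  have hd : d = Module.finrank ℝ (Fin d → ℝ) := (Module.finrank_fin_fun ℝ).symm
  let e₁ := ContinuousLinearEquiv.ofFinrankEq hd
  let e₂ := (e₁.arrowCongr (1 : F ≃L[ℝ] F)).trans (ContinuousLinearEquiv.piRing (Fin d))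
  rw [← Function.id_comp f, ← e₂.symm_comp_self]
  exact e₂.symm.contDiff.contDiffAt.comp x (contDiffAt_pi.mpr fun i => h _)

variable {H : Type*} [NormedAddCommGroup H] [InnerProductSpace ℂ H]
  {E : Type*} [NormedAddCommGroup E] [NormedSpace ℝ E] [FiniteDimensional ℝ E]
  {M : Type*} [TopologicalSpace M] [ChartedSpace E M]

/-- A bilinear form on the tangent spaces, expressed in the chart `e`. -/
noncomputable def chartForm (B : ∀ q : M, LinearMap.BilinForm ℝ (TangentSpace 𝓘(ℝ, E) q))
    (e : OpenPartialHomeomorph M E) (z : E) : E →L[ℝ] E →L[ℝ] ℝ :=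
  LinearMap.toContinuousBilinearMap (LinearMap.compl₁₂ (B (e.symm z) : E →ₗ[ℝ] E →ₗ[ℝ] ℝ)
    (chartSymmDeriv e z).toLinearMap (chartSymmDeriv e z).toLinearMap)

theorem chartForm_apply {B : ∀ q : M, LinearMap.BilinForm ℝ (TangentSpace 𝓘(ℝ, E) q)}
    {e : OpenPartialHomeomorph M E} {q : M} (hq : q ∈ e.source) (a b : E) :
    chartForm B e (e q) a b = B q (chartSymmDeriv e (e q) a) (chartSymmDeriv e (e q) b) := by
  have h : ∀ q', q' = q → ∀ u v : E, B q' u v = B q u v := by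
    rintro q' rfl u v
    rfl
  exact h _ (e.left_inv hq) _ _

theorem chartForm_chartDeriv_right {B : ∀ q : M, LinearMap.BilinForm ℝ (TangentSpace 𝓘(ℝ, E) q)}
    {e : OpenPartialHomeomorph M E} (he : e.MDifferentiable 𝓘(ℝ, E) 𝓘(ℝ, E)) {q : M}
    (hq : q ∈ e.source) (a v : E) :
    chartForm B e (e q) a (chartDeriv e q v) = B q (chartSymmDeriv e (e q) a) v := by
  have h : ∀ w : E, w = v → B q (chartSymmDeriv e (e q) a) w = B q (chartSymmDeriv e (e q) a) v := by
    rintro w rfl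
    rfl
  exact (chartForm_apply hq _ _).trans (h _ (chartSymmDeriv_chartDeriv he hq v))

theorem chartForm_chartDeriv {B : ∀ q : M, LinearMap.BilinForm ℝ (TangentSpace 𝓘(ℝ, E) q)}
    {e : OpenPartialHomeomorph M E} (he : e.MDifferentiable 𝓘(ℝ, E) 𝓘(ℝ, E)) {q : M}
    (hq : q ∈ e.source) (u v : E) :
    chartForm B e (e q) (chartDeriv e q u) (chartDeriv e q v) = B q u v := by
  have h : ∀ w : E, w = u → B q w v = B q u v := by
    rintro w rfl
    rfl
  exact (chartForm_chartDeriv_right he hq _ v).trans (h _ (chartSymmDeriv_chartDeriv he hq u))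

theorem chartForm_chartDeriv_left {B : ∀ q : M, LinearMap.BilinForm ℝ (TangentSpace 𝓘(ℝ, E) q)}
    {e : OpenPartialHomeomorph M E} (he : e.MDifferentiable 𝓘(ℝ, E) 𝓘(ℝ, E)) {q : M}
    (hq : q ∈ e.source) (u b : E) :
    chartForm B e (e q) (chartDeriv e q u) b = B q u (chartSymmDeriv e (e q) b) := by
  have h : chartDeriv e q (chartSymmDeriv e (e q) b) = b := chartDeriv_chartSymmDeriv he hq b
  have h1 := chartForm_chartDeriv (B := B) he hq u (chartSymmDeriv e (e q) b)
  rw [h] at h1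
  exact h1

/-- The differential of the chart is an isomorphism that carries one kernel onto the other; this
brings the constant-rank hypothesis into the chart. -/
theorem finrank_ker_chartForm {B : ∀ q : M, LinearMap.BilinForm ℝ (TangentSpace 𝓘(ℝ, E) q)}
    {e : OpenPartialHomeomorph M E} (he : e.MDifferentiable 𝓘(ℝ, E) 𝓘(ℝ, E)) {q : M}
    (hq : q ∈ e.source) :
    Module.finrank ℝ (LinearMap.ker (chartForm B e (e q)).toLinearMap) =
      Module.finrank ℝ (LinearMap.ker (B q)) := by
  let D : TangentSpace 𝓘(ℝ, E) q ≃ₗ[ℝ] E :=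
    { toFun := fun u => chartDeriv e q u
      map_add' := fun u v => (chartDeriv e q).map_add u v
      map_smul' := fun c u => (chartDeriv e q).map_smul c u
      invFun := fun a => chartSymmDeriv e (e q) a
      left_inv := fun u => chartSymmDeriv_chartDeriv he hq u
      right_inv := fun a => chartDeriv_chartSymmDeriv he hq a }
  have h : LinearMap.ker (chartForm B e (e q)).toLinearMap =
      (LinearMap.ker (B q)).map (D : TangentSpace 𝓘(ℝ, E) q →ₗ[ℝ] E) := by
    ext a
    constructor
    · intro ha
      refine ⟨D.symm a, LinearMap.ext fun v => ?_, D.apply_symm_apply a⟩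
      have h1 : chartForm B e (e q) a (chartDeriv e q v) = 0 := by
        rw [show chartForm B e (e q) a = 0 from ha]
        rfl
      exact (chartForm_chartDeriv_right he hq a v).symm.trans h1
    · rintro ⟨u, hu, rfl⟩
      refine ContinuousLinearMap.ext fun b => ?_
      exact (chartForm_chartDeriv_left he hq u b).trans
        (DFunLike.congr_fun (show B q u = 0 from hu) _)
  rw [h, LinearEquiv.finrank_map_eq]

namespace VariationalManifold

variable (V : VariationalManifold H E M)

/-- The components of both forms are rational expressions in inner products of one smooth lift and
its first derivatives in the chart. -/
theorem contDiffAt_chartForm [IsManifold 𝓘(ℝ, E) ∞ M] (p : M) :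
    ContDiffAt ℝ 1 (chartForm V.metric (chartAt E p)) (chartAt E p p) ∧
      ContDiffAt ℝ 1 (chartForm V.symp (chartAt E p)) (chartAt E p p) := by
  have : IsManifold 𝓘(ℝ, E) 1 M := IsManifold.of_le (n := ∞) (by simp)
  have he : (chartAt E p).MDifferentiable 𝓘(ℝ, E) 𝓘(ℝ, E) := mdifferentiable_chart p
  have hp := mem_chart_source E p
  have hsm : ContMDiffOn 𝓘(ℝ, E) 𝓘(ℝ, E) ∞ (chartAt E p).symm (chartAt E p).target :=
    contMDiffOn_chart_symm
  set e := chartAt E p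
  set φ := V.lift p
  have hφ : IsLift (E := E) V.state φ p := V.isLift_lift p
  let Φ : E → H := fun z => φ (e.symm z)
  have hev : ∀ᶠ z in 𝓝 (e p), z ∈ e.target ∧ IsLift (E := E) V.state φ (e.symm z) := by
    filter_upwards [e.open_target.mem_nhds (e.map_source hp),
      eventually_nhds_chart_symm hp hφ.eventually] with z h1 h2 using ⟨h1, h2⟩
  have hΦ : ContDiffAt ℝ ∞ Φ (e p) := by
    rw [← contMDiffAt_iff_contDiffAt]
    have h1 : ContMDiffAt 𝓘(ℝ, E) 𝓘(ℝ, H) ∞ φ (e.symm (e p)) := by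
      rw [e.left_inv hp]
      exact hφ.self_of_nhds.1
    exact h1.comp (e p) (hsm.contMDiffAt (e.open_target.mem_nhds (e.map_source hp)))
  have hΦ1 : ContDiffAt ℝ 1 Φ (e p) := hΦ.of_le (by simp)
  have hΦ0 : Φ (e p) ≠ 0 := by
    change φ (e.symm (e p)) ≠ 0
    rw [e.left_inv hp]
    exact hφ.ne_zero
  have hnorm : ContDiffAt ℝ 1 (fun z => ‖Φ z‖ ^ 2) (e p) := hΦ1.norm_sq ℂ
  have hnorm0 : ‖Φ (e p)‖ ^ 2 ≠ 0 := pow_ne_zero 2 (norm_ne_zero_iff.2 hΦ0)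
  let F : E → E → H := fun a z => projPerp (Φ z) (fderiv ℝ Φ z a)
  have hF : ∀ a, ContDiffAt ℝ 1 (F a) (e p) := by
    intro a
    have h1 : ContDiffAt ℝ 1 (fun z => fderiv ℝ Φ z a) (e p) :=
      (hΦ.fderiv_right (m := 1) (by norm_cast)).clm_apply contDiffAt_const
    have h2 : ContDiffAt ℝ 1 (fun z => ⟪Φ z, fderiv ℝ Φ z a⟫_ℂ / ⟪Φ z, Φ z⟫_ℂ) (e p) :=
      (hΦ1.inner ℂ h1).mul ((hΦ1.inner ℂ hΦ1).inv (inner_self_ne_zero.2 hΦ0))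
    exact h1.sub (h2.smul hΦ1)
  have hframe : ∀ z ∈ e.target, IsLift (E := E) V.state φ (e.symm z) → ∀ a,
      frame (E := E) φ (e.symm z) (chartSymmDeriv e z a) = F a z := by
    intro z hz hl a
    have h1 := chartDeriv_chartSymmDeriv he (e.map_target hz) a
    have h2 := frame_eq_fderiv_chart he (e.map_target hz) hl (chartSymmDeriv e (e (e.symm z)) a)
    have h3 := h2.trans (congrArg (fun b => projPerp (Φ z) (fderiv ℝ Φ (e (e.symm z)) b)) h1)
    rwa [e.right_inv hz] at h3
  have hin : ∀ a b, ContDiffAt ℝ 1 (fun z => ⟪F a z, F b z⟫_ℂ) (e p) := fun a b =>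
    (hF a).inner ℂ (hF b)
  constructor
  · refine contDiffAt_clm_of_apply fun a => contDiffAt_clm_of_apply fun b => ?_
    have h1 : ContDiffAt ℝ 1 (fun z => 2 * ((⟪F a z, F b z⟫_ℂ).re / ‖Φ z‖ ^ 2)) (e p) :=
      contDiffAt_const.mul ((Complex.reCLM.contDiff.contDiffAt.comp (e p) (hin a b)).div hnorm
        hnorm0)
    refine h1.congr_of_eventuallyEq ?_
    filter_upwards [hev] with z hz
    rw [← hframe z hz.1 hz.2, ← hframe z hz.1 hz.2]
    exact V.metric_eq hz.2 _ _
  · refine contDiffAt_clm_of_apply fun a => contDiffAt_clm_of_apply fun b => ?_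
    have h1 : ContDiffAt ℝ 1 (fun z => 2 * ((⟪F a z, F b z⟫_ℂ).im / ‖Φ z‖ ^ 2)) (e p) :=
      contDiffAt_const.mul ((Complex.imCLM.contDiff.contDiffAt.comp (e p) (hin a b)).div hnorm
        hnorm0)
    refine h1.congr_of_eventuallyEq ?_
    filter_upwards [hev] with z hz
    rw [← hframe z hz.1 hz.2, ← hframe z hz.1 hz.2]
    exact V.symp_eq hz.2 _ _

/-- Where the rank of the symplectic form does not jump, its pseudo-inverse is given in a chart by
a `C¹` family of linear maps. -/
theorem exists_contDiffAt_Omega [IsManifold 𝓘(ℝ, E) ∞ M] (p : M)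
    (hrank : ∀ᶠ y in 𝓝 p, Module.finrank ℝ (LinearMap.ker (V.symp y)) =
      Module.finrank ℝ (LinearMap.ker (V.symp p))) :
    ∃ O : E → (E →L[ℝ] ℝ) →L[ℝ] E, ContDiffAt ℝ 1 O (chartAt E p p) ∧
      ∀ᶠ q in 𝓝 p, ∀ (α : Module.Dual ℝ (TangentSpace 𝓘(ℝ, E) q)) (β : E →L[ℝ] ℝ),
        (∀ u : E, α u = β (chartDeriv (chartAt E p) q u)) →
          chartDeriv (chartAt E p) q (V.Omega q α) = O (chartAt E p q) β := by
  have : IsManifold 𝓘(ℝ, E) 1 M := IsManifold.of_le (n := ∞) (by simp)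
  have he : (chartAt E p).MDifferentiable 𝓘(ℝ, E) 𝓘(ℝ, E) := mdifferentiable_chart p
  have hp := mem_chart_source E p
  obtain ⟨hg, hw⟩ := V.contDiffAt_chartForm p
  set e := chartAt E p
  have hev : ∀ {Q : E → Prop}, (∀ᶠ q in 𝓝 p, q ∈ e.source → Q (e q)) → ∀ᶠ z in 𝓝 (e p), Q z := by
    intro Q hQ
    filter_upwards [eventually_nhds_chart_symm hp hQ,
      e.open_target.mem_nhds (e.map_source hp)] with z h1 h2
    have h3 := h1 (e.map_target h2)
    rwa [e.right_inv h2] at h3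
  obtain ⟨O, hO, hOev⟩ := exists_contDiffAt_isPseudoInverseAt hg hw
    (hev (Eventually.of_forall fun q hq u v => by
      rw [chartForm_apply hq, chartForm_apply hq]
      exact V.metric_symm q _ _))
    (hev (Eventually.of_forall fun q hq u hu => by
      rw [chartForm_apply hq]
      refine V.metric_pos q _ fun h0 => hu ?_
      rw [← chartDeriv_chartSymmDeriv he hq u]
      exact (congrArg (chartDeriv e q) h0).trans (map_zero _)))
    (hev (Eventually.of_forall fun q hq u v => by
      rw [chartForm_apply hq, chartForm_apply hq]
      exact V.symp_antisymm q _ _))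
    (hev (by
      filter_upwards [hrank] with q hq hqs
      rw [finrank_ker_chartForm he hqs, finrank_ker_chartForm he hp, hq]))
  refine ⟨O, hO, ?_⟩
  filter_upwards [(e.continuousAt hp).eventually hOev, e.open_source.mem_nhds hp] with q hq hqs α β hαβ
  obtain ⟨h1, h2⟩ := hq β
  have hker : ∀ v : E, V.symp q v = 0 → chartForm V.symp e (e q) (chartDeriv e q v) = 0 := by
    intro v hv
    refine ContinuousLinearMap.ext fun b => ?_
    exact (chartForm_chartDeriv_left he hqs v b).trans (DFunLike.congr_fun hv _)
  have hker' : ∀ a : E, chartForm V.symp e (e q) a = 0 →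
      V.symp q (chartSymmDeriv e (e q) a) = 0 := by
    intro a ha
    refine LinearMap.ext fun v => ?_
    have h3 : chartForm V.symp e (e q) a (chartDeriv e q v) = 0 := by
      rw [ha]
      rfl
    exact (chartForm_chartDeriv_right he hqs a v).symm.trans h3
  -- The chart solution, pulled back to the tangent space, satisfies the defining conditions, so
  -- uniqueness identifies it with `Ω α`.
  have hX : V.Omega q α = chartSymmDeriv e (e q) (O (e q) β) := by
    refine V.Omega_eq ⟨fun v hv => ?_, fun u hu => ?_⟩
    · exact (chartForm_chartDeriv_left he hqs v _).symm.trans (h1 _ (hker v hv))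
    · have h3 := h2 (chartDeriv e q u) fun a ha =>
        (chartForm_chartDeriv_right he hqs a u).trans (hu _ (hker' a ha))
      exact (chartForm_chartDeriv_left he hqs u _).symm.trans (h3.trans (hαβ u).symm)
  have h5 := congrArg (chartDeriv e q) hX
  exact h5.trans (chartDeriv_chartSymmDeriv he hqs _)

/-- In a chart, the differentials of the perturbation are jointly continuous in time and space. -/
theorem continuousOn_fderiv_expect [IsManifold 𝓘(ℝ, E) ∞ M] (p : M) {A : ℝ → H →ₗ.[ℂ] H}
    {T : Set ℝ} (hAdiff : ∀ s ∈ T, ContMDiff 𝓘(ℝ, E) 𝓘(ℝ, ℝ) 1 (V.expect (A s)))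
    (hAcont : ContinuousOn
      (fun q : ℝ × TangentBundle 𝓘(ℝ, E) M => V.dExpect (A q.1) q.2.proj q.2.snd)
      (T ×ˢ univ)) :
    ContinuousOn (fun x : ℝ × E => fderiv ℝ (fun z => V.expect (A x.1) ((chartAt E p).symm z)) x.2)
      (T ×ˢ (chartAt E p).target) := by
  have : IsManifold 𝓘(ℝ, E) 1 M := IsManifold.of_le (n := ∞) (by simp)
  have he : (chartAt E p).MDifferentiable 𝓘(ℝ, E) 𝓘(ℝ, E) := mdifferentiable_chart p
  have hsm : ContMDiffOn 𝓘(ℝ, E) 𝓘(ℝ, E) 1 (chartAt E p).symm (chartAt E p).target :=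
    contMDiffOn_chart_symm
  set e := chartAt E p
  refine continuousOn_clm_apply.2 fun a => ?_
  -- `τ` is the coordinate vector field in the direction `a`. Composing the hypothesis on the
  -- tangent bundle with it gives continuity of each component of the differential.
  let τ : E → TangentBundle 𝓘(ℝ, E) M := fun z =>
    tangentMapWithin 𝓘(ℝ, E) 𝓘(ℝ, E) e.symm e.target ⟨z, a⟩
  have hτ : ContinuousOn τ e.target := by
    have h1 := hsm.continuousOn_tangentMapWithin le_rfl e.open_target.uniqueMDiffOn
    have h2 : Continuous fun z : E => (⟨z, a⟩ : TangentBundle 𝓘(ℝ, E) E) :=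
      (tangentBundleModelSpaceHomeomorph 𝓘(ℝ, E)).symm.continuous.comp
        (continuous_id.prodMk continuous_const)
    exact h1.comp h2.continuousOn fun z hz => hz
  have hc : ContinuousOn (fun x : ℝ × E => (x.1, τ x.2)) (T ×ˢ e.target) :=
    continuousOn_fst.prodMk (hτ.comp continuousOn_snd fun x hx => hx.2)
  refine (hAcont.comp hc fun x hx => ⟨hx.1, mem_univ _⟩).congr ?_
  rintro ⟨s, z⟩ ⟨hs, hz⟩
  have hmd := (hAdiff s hs).mdifferentiable one_ne_zero (e.symm z)
  have h1 := V.dExpect_eq_fderiv_chart he (e.map_target hz) hmd (chartSymmDeriv e z a)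
  have h2 := chartDeriv_chartSymmDeriv he (e.map_target hz) a
  rw [e.right_inv hz] at h1 h2
  rw [h2] at h1
  refine h1.symm.trans ?_
  have h3 : mfderivWithin 𝓘(ℝ, E) 𝓘(ℝ, E) e.symm e.target z = mfderiv 𝓘(ℝ, E) 𝓘(ℝ, E) e.symm z :=
    mfderivWithin_of_mem_nhds (e.open_target.mem_nhds hz)
  have h4 : τ z = ⟨e.symm z, mfderiv 𝓘(ℝ, E) 𝓘(ℝ, E) e.symm z a⟩ := by
    rw [← h3]
    rfl
  simp only [Function.comp_apply]
  rw [h4]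
  rfl

end VariationalManifold

end FieldsInCharts

/-! ### The projected evolution field and its perturbation. -/

section ProjectedEvolutions

variable {H : Type*} [NormedAddCommGroup H] [InnerProductSpace ℂ H]
  {E : Type*} [NormedAddCommGroup E] [NormedSpace ℝ E]
  {M : Type*} [TopologicalSpace M] [ChartedSpace E M]

namespace VariationalManifold

variable (V : VariationalManifold H E M)

/-- The domain of the sum is the intersection of the two domains; the domain hypotheses exclude the
default value `0` in `expectation`. -/
theorem expect_add_smul {A B : H →ₗ.[ℂ] H} (hA : V.InDomain A) (hB : V.InDomain B) (ε : ℝ)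
    (x : M) : V.expect (A + (ε : ℂ) • B) x = V.expect A x + ε * V.expect B x := by
  have hmem : (V.state x).rep ∈ (V.state x).submodule := by
    rw [Projectivization.submodule_eq]
    exact Submodule.mem_span_singleton_self _
  have h1 : (V.state x).rep ∈ A.domain := hA x hmem
  have h2 : (V.state x).rep ∈ B.domain := hB x hmem
  have h3 : (V.state x).rep ∈ (A + (ε : ℂ) • B).domain := ⟨h1, h2⟩
  simp only [expect, expectation]
  rw [dif_pos h1, dif_pos h2, dif_pos h3]
  have h4 : (A + (ε : ℂ) • B) ⟨_, h3⟩ = A ⟨_, h1⟩ + (ε : ℂ) • B ⟨_, h2⟩ := rfl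
  rw [h4, inner_add_right, inner_smul_right, Complex.add_re, Complex.re_ofReal_mul]
  ring

theorem dExpect_add_smul {A B : H →ₗ.[ℂ] H} (hA : V.InDomain A) (hB : V.InDomain B) {x : M}
    (hA' : MDifferentiableAt 𝓘(ℝ, E) 𝓘(ℝ, ℝ) (V.expect A) x)
    (hB' : MDifferentiableAt 𝓘(ℝ, E) 𝓘(ℝ, ℝ) (V.expect B) x) (ε : ℝ) :
    V.dExpect (A + (ε : ℂ) • B) x = V.dExpect A x + ε • V.dExpect B x := by
  have h : V.expect (A + (ε : ℂ) • B) = V.expect A + ε • V.expect B :=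
    funext fun y => V.expect_add_smul hA hB ε y
  have h1 := (hA'.hasMFDerivAt.add (hB'.hasMFDerivAt.const_smul ε)).mfderiv
  rw [dExpect, h]
  refine LinearMap.ext fun u => ?_
  exact DFunLike.congr_fun h1 u

theorem dExpect_eq_zero {A : H →ₗ.[ℂ] H} (hA : ∀ x, V.expect A x = 0) (x : M) :
    V.dExpect A x = 0 := by
  have h : V.expect A = fun _ => 0 := funext hA
  rw [dExpect, h, mfderiv_const]
  rfl

/-- The only property of the chosen flow that enters the response theory; its uniqueness near the
trajectory comes from flow boxes. -/
theorem reaches_flow (A : H →ₗ.[ℂ] H) {τ : ℝ} (hτ : 0 ≤ τ) {q : M}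
    (h : ∃ z, Reaches (V.lagrangianField A) τ q z) :
    Reaches (V.lagrangianField A) τ q (V.flow A τ q) := by
  have h1 : ∃ c : ℝ → M, c 0 = q ∧
      IsMIntegralCurveOn (I := 𝓘(ℝ, E)) c (V.lagrangianField A) (uIcc 0 τ) := by
    obtain ⟨-, c, h0, hc, -⟩ := h
    exact ⟨c, h0, by rwa [uIcc_of_le hτ]⟩
  rw [flow, dif_pos h1]
  exact ⟨h1.choose, h1.choose_spec.1, h1.choose_spec.2.mono (uIcc_of_le hτ).ge, rfl⟩

/-- Differentiability of a family of points of the manifold gives differentiability of the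
representatives, with the corresponding horizontal derivative. -/
theorem isPropagatedPerturbation {γ : ℝ → ℝ → M} {t : ℝ} {δ : E}
    (h : HasMFDerivAt 𝓘(ℝ, ℝ) 𝓘(ℝ, E) (fun ε => γ ε t) 0
      ((1 : ℝ →L[ℝ] ℝ).smulRight δ : ℝ →L[ℝ] E)) : V.IsPropagatedPerturbation γ t δ := by
  intro φ hφ
  have h1 : HasFDerivAt (fun ε => φ (γ ε t))
      ((mfderiv 𝓘(ℝ, E) 𝓘(ℝ, H) φ (γ 0 t) : E →L[ℝ] H).comp
        ((1 : ℝ →L[ℝ] ℝ).smulRight δ : ℝ →L[ℝ] E)) 0 :=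
    (hφ.mdifferentiableAt.hasMFDerivAt.comp (0 : ℝ) h).hasFDerivAt
  have h3 : HasDerivAt (fun ε => φ (γ ε t)) _ 0 := hasFDerivAt_iff_hasDerivAt.1 h1
  refine ⟨_, h3, ?_⟩
  have h2 : ((1 : ℝ →L[ℝ] ℝ).smulRight δ : ℝ →L[ℝ] E) 1 = δ := by simp
  exact congrArg (frame φ (γ 0 t)) h2.symm

theorem Omega_zero [FiniteDimensional ℝ E] (x : M) : V.Omega x 0 = 0 := by
  have h := V.Omega_smul x 0 0
  rwa [zero_smul, zero_smul] at h

theorem lagrangianField_add_smul [FiniteDimensional ℝ E] {A B : H →ₗ.[ℂ] H} (hA : V.InDomain A)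
    (hB : V.InDomain B) {x : M} (hA' : MDifferentiableAt 𝓘(ℝ, E) 𝓘(ℝ, ℝ) (V.expect A) x)
    (hB' : MDifferentiableAt 𝓘(ℝ, E) 𝓘(ℝ, ℝ) (V.expect B) x) (ε : ℝ) :
    V.lagrangianField (A + (ε : ℂ) • B) x =
      V.lagrangianField A x + ε • V.lagrangianField B x := by
  rw [lagrangianField, V.dExpect_add_smul hA hB hA' hB', V.Omega_add, V.Omega_smul, neg_add,
    ← smul_neg]
  rfl

variable [FiniteDimensional ℝ E] [IsManifold 𝓘(ℝ, E) ∞ M]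

/-- The local regularity of the free and of the perturbing vector fields. -/
theorem exists_lagrangianField_chart (p : M)
    (hrank : ∀ᶠ y in 𝓝 p, Module.finrank ℝ (LinearMap.ker (V.symp y)) =
      Module.finrank ℝ (LinearMap.ker (V.symp p)))
    {H₀ : H →ₗ.[ℂ] H} (hE : ContMDiff 𝓘(ℝ, E) 𝓘(ℝ, ℝ) 2 (V.expect H₀)) {A : ℝ → H →ₗ.[ℂ] H}
    {T : Set ℝ} (hAdiff : ∀ s ∈ T, ContMDiff 𝓘(ℝ, E) 𝓘(ℝ, ℝ) 1 (V.expect (A s)))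
    (hAcont : ContinuousOn
      (fun q : ℝ × TangentBundle 𝓘(ℝ, E) M => V.dExpect (A q.1) q.2.proj q.2.snd)
      (T ×ˢ univ)) :
    (∃ f : E → E, ContDiffAt ℝ 1 f (chartAt E p p) ∧
      ∀ᶠ q in 𝓝 p, chartDeriv (chartAt E p) q (V.lagrangianField H₀ q) = f (chartAt E p q)) ∧
    ∃ g : ℝ → E → E, (∃ U ∈ 𝓝 (chartAt E p p),
      ContinuousOn (fun x : ℝ × E => g x.1 x.2) (T ×ˢ U)) ∧
      ∀ᶠ q in 𝓝 p, ∀ s ∈ T,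
        chartDeriv (chartAt E p) q (V.lagrangianField (A s) q) = g s (chartAt E p q) := by
  have : IsManifold 𝓘(ℝ, E) 1 M := IsManifold.of_le (n := ∞) (by simp)
  have : IsManifold 𝓘(ℝ, E) 2 M := IsManifold.of_le (n := ∞) ENat.LEInfty.out
  have he : (chartAt E p).MDifferentiable 𝓘(ℝ, E) 𝓘(ℝ, E) := mdifferentiable_chart p
  have hp := mem_chart_source E p
  have hsm : ContMDiffOn 𝓘(ℝ, E) 𝓘(ℝ, E) 2 (chartAt E p).symm (chartAt E p).target :=
    contMDiffOn_chart_symm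
  have hcont := V.continuousOn_fderiv_expect p hAdiff hAcont
  obtain ⟨O, hO, hOev⟩ := V.exists_contDiffAt_Omega p hrank
  set e := chartAt E p
  have htgt := e.open_target.mem_nhds (e.map_source hp)
  have hfield : ∀ᶠ q in 𝓝 p, ∀ B : H →ₗ.[ℂ] H,
      MDifferentiableAt 𝓘(ℝ, E) 𝓘(ℝ, ℝ) (V.expect B) q →
      chartDeriv e q (V.lagrangianField B q) =
        -O (e q) (fderiv ℝ (fun z => V.expect B (e.symm z)) (e q)) := by
    filter_upwards [hOev, e.open_source.mem_nhds hp] with q h1 h2 B hB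
    have h3 := h1 (V.dExpect B q) _ (V.dExpect_eq_fderiv_chart he h2 hB)
    exact (map_neg (chartDeriv e q) _).trans (congrArg Neg.neg h3)
  -- The energy loses one derivative in the field, so `C²` is what makes the free field `C¹`.
  have hE' : ContDiffAt ℝ 2 (fun z => V.expect H₀ (e.symm z)) (e p) := by
    rw [← contMDiffAt_iff_contDiffAt]
    exact hE.contMDiffAt.comp (e p) (hsm.contMDiffAt htgt)
  refine ⟨⟨fun z => -O z (fderiv ℝ (fun z => V.expect H₀ (e.symm z)) z), ?_, ?_⟩,
    fun s z => -O z (fderiv ℝ (fun z => V.expect (A s) (e.symm z)) z), ?_, ?_⟩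
  · exact (hO.clm_apply (hE'.fderiv_right (m := 1) (by norm_num))).neg
  · filter_upwards [hfield] with q hq using hq H₀ (hE.mdifferentiable two_ne_zero q)
  · refine ⟨{z | ContDiffAt ℝ 1 O z ∧ z ∈ e.target}, ?_, ?_⟩
    · filter_upwards [hO.eventually (by simp), htgt] with z h1 h2 using ⟨h1, h2⟩
    · have h1 : ContinuousOn (fun x : ℝ × E => O x.2)
          (T ×ˢ {z | ContDiffAt ℝ 1 O z ∧ z ∈ e.target}) := fun x hx =>
        (ContinuousAt.comp (f := Prod.snd) hx.2.1.continuousAt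
          continuousAt_snd).continuousWithinAt
      exact (h1.clm_apply (hcont.mono (prod_mono_right fun z hz => hz.2))).neg
  · filter_upwards [hfield] with q hq s hs using
      hq (A s) ((hAdiff s hs).mdifferentiable one_ne_zero q)

end VariationalManifold

end ProjectedEvolutions

/-! ### The linear response theorem. -/

theorem mainTheorem7
    {H : Type*} [NormedAddCommGroup H] [InnerProductSpace ℂ H] [CompleteSpace H]
    {E : Type*} [NormedAddCommGroup E] [NormedSpace ℝ E] [FiniteDimensional ℝ E]
    {M : Type*} [TopologicalSpace M] [T2Space M] [ChartedSpace E M] [IsManifold 𝓘(ℝ, E) ∞ M]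
    (V : VariationalManifold H E M)
    -- the free Hamiltonian
    (H₀ : H →ₗ.[ℂ] H) (hH₀ : H₀.IsFormalAdjoint H₀) (hH₀dom : V.InDomain H₀)
    (hE : ContMDiff 𝓘(ℝ, E) 𝓘(ℝ, ℝ) 2 (V.expect H₀))
    -- the perturbation, on the time interval from the initial time `t₀` to `t`
    (t₀ t : ℝ) (ht : t₀ ≤ t)
    (A : ℝ → H →ₗ.[ℂ] H) (hA : ∀ s, (A s).IsFormalAdjoint (A s))
    (hAdom : ∀ s ∈ Icc t₀ t, V.InDomain (A s))
    (hAdiff : ∀ s ∈ Icc t₀ t, ContMDiff 𝓘(ℝ, E) 𝓘(ℝ, ℝ) 1 (V.expect (A s)))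
    (hAcont : ContinuousOn
      (fun q : ℝ × TangentBundle 𝓘(ℝ, E) M => V.dExpect (A q.1) q.2.proj q.2.snd)
      (Icc t₀ t ×ˢ univ))
    -- the free evolution `γ 0` and the perturbed evolutions `γ ε`, with the same initial state
    (γ : ℝ → ℝ → M)
    (hfree : V.IsProjectedEvolution (fun _ => H₀) t₀ t (γ 0))
    (hpert : ∀ᶠ ε : ℝ in 𝓝[≠] 0,
      V.IsProjectedEvolution (fun s => H₀ + (ε : ℂ) • A s) t₀ t (γ ε) ∧ γ ε t₀ = γ 0 t₀)
    -- the rank of the restricted symplectic form does not jump along the free evolution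
    (hrank : ∀ s ∈ Icc t₀ t, ∀ᶠ y in 𝓝 (γ 0 s),
      Module.finrank ℝ (LinearMap.ker (V.symp y)) =
        Module.finrank ℝ (LinearMap.ker (V.symp (γ 0 s)))) :
    (∀ s ∈ Icc t₀ t, V.flow H₀ (t - s) (γ 0 s) = γ 0 t ∧
      MDifferentiableAt 𝓘(ℝ, E) 𝓘(ℝ, E) (V.flow H₀ (t - s)) (γ 0 s)) ∧
    IntervalIntegrable (V.propagated H₀ A (γ 0) t) volume t₀ t ∧
    HasMFDerivAt 𝓘(ℝ, ℝ) 𝓘(ℝ, E) (fun ε => γ ε t) 0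
      ((1 : ℝ →L[ℝ] ℝ).smulRight
        (-∫ s in t₀..t, V.propagated H₀ A (γ 0) t s : E)) ∧
    V.IsPropagatedPerturbation γ t (-∫ s in t₀..t, V.propagated H₀ A (γ 0) t s : E) ∧
    ((∀ s < t₀, ∀ x, V.expect (A s) x = 0) →
      IntegrableOn (V.propagated H₀ A (γ 0) t) (Iic t) volume ∧
      V.IsPropagatedPerturbation γ t (-∫ s in Iic t, V.propagated H₀ A (γ 0) t s : E)) := by
  have hreach := fun τ q hτ => V.reaches_flow H₀ (τ := τ) (q := q) hτ
  have hγ : ∀ᶠ ε : ℝ in 𝓝[≠] 0, (∀ s ∈ Icc t₀ t, HasVelocityWithinAt (E := E) (γ ε)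
      (V.lagrangianField H₀ (γ ε s) + ε • V.lagrangianField (A s) (γ ε s)) (Icc t₀ t) s) ∧
      γ ε t₀ = γ 0 t₀ := by
    filter_upwards [hpert] with ε ⟨h1, h2⟩
    refine ⟨fun s hs => ?_, h2⟩
    have h3 := V.lagrangianField_add_smul hH₀dom (hAdom s hs)
      (hE.mdifferentiable two_ne_zero (γ ε s)) ((hAdiff s hs).mdifferentiable one_ne_zero (γ ε s)) ε
    have h4 := h1 s hs
    rw [h3] at h4
    exact h4
  have hR := hasLinearResponse (Y := fun s => V.lagrangianField (A s)) ht hreach hfree hγ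
    fun s hs => by
      have : IsManifold 𝓘(ℝ, E) 1 M := IsManifold.of_le (n := ∞) (by simp)
      obtain ⟨⟨f, hf, hf'⟩, hg⟩ :=
        V.exists_lagrangianField_chart (γ 0 s) (hrank s hs) hE hAdiff hAcont
      exact ⟨chartAt E (γ 0 s), mdifferentiable_chart _, mem_chart_source E _, f, hf, hf', hg⟩
  -- The source is the field `-Ω dA(s)`, whence the minus sign of the response formula.
  have hprop : transportedSource (V.flow H₀) (fun s => V.lagrangianField (A s)) (γ 0) t =
      -V.propagated H₀ A (γ 0) t := funext fun s =>
    map_neg (mfderiv 𝓘(ℝ, E) 𝓘(ℝ, E) (V.flow H₀ (t - s)) (γ 0 s) :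
      TangentSpace 𝓘(ℝ, E) (γ 0 s) →L[ℝ] E) _
  have hint : IntervalIntegrable (V.propagated H₀ A (γ 0) t) volume t₀ t := by
    have h := hR.intervalIntegrable.neg
    rwa [hprop, neg_neg] at h
  have hderiv : HasMFDerivAt 𝓘(ℝ, ℝ) 𝓘(ℝ, E) (fun ε => γ ε t) 0
      ((1 : ℝ →L[ℝ] ℝ).smulRight (-∫ s in t₀..t, V.propagated H₀ A (γ 0) t s : E)) := by
    have h := hR.hasMFDerivAt
    have h1 : (∫ s in t₀..t, transportedSource (V.flow H₀) (fun s => V.lagrangianField (A s))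
        (γ 0) t s) = -∫ s in t₀..t, V.propagated H₀ A (γ 0) t s := by
      rw [hprop]
      exact intervalIntegral.integral_neg
    rw [h1] at h
    exact h
  have hpp := V.isPropagatedPerturbation hderiv
  refine ⟨fun s hs => ⟨?_, hR.mdifferentiableAt s hs⟩, hint, hderiv, hpp, fun hzero => ?_⟩
  · have h1 : Reaches (V.lagrangianField H₀) (t - s) (γ 0 s) (γ 0 t) :=
      IsMIntegralCurveOn.reaches
        (IsMIntegralCurveOn.mono (γ := γ 0) (v := V.lagrangianField H₀) hfree
          (Icc_subset_Icc_left hs.1))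
    exact (hR.existsUnique_reaches s hs).self_of_nhds.unique
      (hreach _ _ (sub_nonneg.2 hs.2) ⟨_, h1⟩) h1
  -- Before `t₀` the covector `∂A(s)` vanishes, so the integrand is zero whatever the flow and the
  -- curve are there.
  · have h0 : ∀ s ∈ Iic t \ Icc t₀ t, V.propagated H₀ A (γ 0) t s = 0 := by
      intro s hs
      have hs' : s < t₀ := lt_of_not_ge fun h => hs.2 ⟨h, hs.1⟩
      rw [VariationalManifold.propagated, V.dExpect_eq_zero (hzero s hs'), V.Omega_zero]
      exact map_zero _
    have hI : IntegrableOn (V.propagated H₀ A (γ 0) t) (Icc t₀ t) volume :=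
      (integrableOn_Icc_iff_integrableOn_Ioc (by simp)).2
        ((intervalIntegrable_iff_integrableOn_Ioc_of_le ht).1 hint)
    refine ⟨hI.of_forall_sdiff_eq_zero measurableSet_Iic h0, ?_⟩
    have h1 : (∫ s in Iic t, V.propagated H₀ A (γ 0) t s) =
        ∫ s in t₀..t, V.propagated H₀ A (γ 0) t s := by
      rw [setIntegral_eq_of_subset_of_forall_sdiff_eq_zero measurableSet_Iic Icc_subset_Iic_self h0,
        integral_Icc_eq_integral_Ioc, intervalIntegral.integral_of_le ht]
    rw [h1]
    exact hpp
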